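/- **Corollary 2.10 (Berry phase formula).** Let $\ell>0$, let $\Gamma:\mathbb R\to\mathbb R^3$ be smooth and let $t_0<t_1$ with $\Gamma(t_0)=\Gamma(t_1)$ (a closed front track); put $\mathbf v=\dot\Gamma$. The $\ell$-bicycle monodromy $M_\ell:S^2\to S^2$ sends $\mathbf x$ to $\mathbf r(t_1)$, where $\mathbf r(t)\in S^2$ is the solution of the bicycle equation $$\ell\,\dot{\mathbf r}=-\mathbf v+(\mathbf v\cdot\mathbf r)\,\mathbf r,\qquad \mathbf r(t_0)=\mathbf x .$$ Let $\mathbf r_0\in S^2$ be a fixed point of $M_\ell$, let $\mathbf r(t)$ be the solution with $\mathbf r(t_0)=\mathbf r_0$, and let $\gamma=\Gamma+\ell\mathbf r$ be the corresponding closed rear track over $[t_0,t_1]$, whose signed length is $$L_\gamma=-\int_{t_0}^{t_1}\mathbf r\cdot\mathbf v\,dt .$$ Orient $S^2$ by its outward normal and identify complex numbers with linear maps of $T_{\mathbf r_0}S^2=\mathbf r_0^\perp$ by letting $i$ act as the positive quarter turn $\boldsymbol\xi\mapsto\mathbf r_0\times\boldsymbol\xi$. Then $M_\ell$ is differentiable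 at $\mathbf r_0$ and $$M_\ell'(\mathbf r_0)=e^{-L_\gamma/\ell+i\Omega},$$ where $\Omega$ is the algebraic (signed) area in $S^2$ enclosed by the closed curve $\mathbf r(t)$, $t_0\le t\le t_1$; that is, for an arbitrary point $p\in S^2$ not on this curve, $$\Omega=\int_{S^2}w_p(x)\,dA(x),$$ $w_p(x)$ being the winding number of the curve around $x$ in $S^2\setminus\{p\}$, identified with an oriented plane by the orientation-preserving stereographic projection from $p$. (Another choice of $p$ changes $\Omega$ by a multiple of $4\pi$. The curve $\mathbf r(t)$ need not be simple.) -/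

import Mathlib

open Set Metric MeasureTheory
open scoped Manifold ContDiff RealInnerProductSpace NNReal

namespace Bicycle

/-- Euclidean three-space. -/
abbrev E3 : Type := EuclideanSpace ℝ (Fin 3)

/-- The unit sphere `S²`. -/
abbrev S2 : Type := sphere (0 : E3) 1

/-- The cross product of `ℝ³`, with its standard orientation. -/
noncomputable def cross (x y : E3) : E3 :=
  WithLp.toLp 2 (crossProduct (WithLp.ofLp x) (WithLp.ofLp y))

/-! ### The bicycle equation and its flow -/

/-- `r : ℝ → S²` solves the `ℓ`-bicycle equation `ℓ r' = -v + (v ⬝ r) r`, `v = Γ'`,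
along the front track `Γ`. -/
def IsBicycleMotion (Γ : ℝ → E3) (ℓ : ℝ) (r : ℝ → S2) : Prop :=
  ∀ t, HasDerivAt (fun s => (r s : E3))
    (ℓ⁻¹ • (-deriv Γ t + ⟪deriv Γ t, (r t : E3)⟫ • (r t : E3))) t

/-- A bounded vector field that agrees with that of the bicycle equation on the unit sphere. -/
noncomputable def auxField (v : ℝ → E3) (ℓ : ℝ) (t : ℝ) (x : E3) : E3 :=
  ℓ⁻¹ • (-v t + (2 * (1 + ‖x‖ ^ 2)⁻¹ * ⟪v t, x⟫) • x)

theorem auxField_lipschitz (v : ℝ → E3) (hv : Continuous v) (ℓ t₀ T a : ℝ) (x₀ : E3) :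
    ∃ K : ℝ≥0, ∀ t ∈ Icc (t₀ - T) (t₀ + T),
      LipschitzOnWith K (auxField v ℓ t) (closedBall x₀ a) := by
  have hsm : ContDiff ℝ 1
      (fun x : E3 => (2 * (1 + ‖x‖ ^ 2)⁻¹) • (innerSL ℝ x).smulRight x) := by
    have h1 : ContDiff ℝ 1 (fun x : E3 => (1 + ‖x‖ ^ 2)⁻¹) :=
      (contDiff_const.add (contDiff_norm_sq ℝ)).inv (fun x => by positivity)
    exact (contDiff_const.mul h1).smul ((innerSL ℝ).contDiff.smulRight contDiff_id)
  obtain ⟨K, hK⟩ := hsm.contDiffOn.exists_lipschitzOnWith one_ne_zero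
    (convex_closedBall x₀ a) (isCompact_closedBall x₀ a)
  obtain ⟨V, hV⟩ := (isCompact_Icc (a := t₀ - T) (b := t₀ + T)).exists_bound_of_continuousOn
    hv.continuousOn
  refine ⟨Real.toNNReal (|ℓ⁻¹| * (K * V)), fun t ht => ?_⟩
  refine LipschitzOnWith.of_dist_le_mul fun x hx y hy => ?_
  have h := hK.dist_le_mul x hx y hy
  rw [dist_eq_norm] at h ⊢
  have e : auxField v ℓ t x - auxField v ℓ t y = ℓ⁻¹ •
      (((2 * (1 + ‖x‖ ^ 2)⁻¹) • (innerSL ℝ x).smulRight x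
        - (2 * (1 + ‖y‖ ^ 2)⁻¹) • (innerSL ℝ y).smulRight y : E3 →L[ℝ] E3) (v t)) := by
    simp only [auxField, sub_apply, smul_apply,
      ContinuousLinearMap.smulRight_apply, innerSL_apply_apply, ← smul_sub, smul_smul,
      real_inner_comm (v t)]
    congr 1
    abel
  rw [e, norm_smul, Real.norm_eq_abs]
  have hb := (ContinuousLinearMap.le_opNorm
    ((2 * (1 + ‖x‖ ^ 2)⁻¹) • (innerSL ℝ x).smulRight x
        - (2 * (1 + ‖y‖ ^ 2)⁻¹) • (innerSL ℝ y).smulRight y : E3 →L[ℝ] E3) (v t))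
  have hV0 : 0 ≤ V := (norm_nonneg _).trans (hV t ht)
  calc _ ≤ |ℓ⁻¹| * ((K * dist x y) * V) := by
        gcongr
        exact hb.trans (mul_le_mul h (hV t ht) (norm_nonneg _) (by positivity))
    _ = _ := by
        rw [Real.coe_toNNReal _ (by positivity)]; ring

theorem exists_auxField_solution (v : ℝ → E3) (hv : Continuous v) (ℓ t₀ T : ℝ) (hT : 0 < T)
    (x₀ : E3) :
    ∃ r : ℝ → E3, r t₀ = x₀ ∧
      ∀ t ∈ Ioo (t₀ - T) (t₀ + T), HasDerivAt r (auxField v ℓ t (r t)) t := by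
  obtain ⟨V, hV⟩ := (isCompact_Icc (a := t₀ - T) (b := t₀ + T)).exists_bound_of_continuousOn
    hv.continuousOn
  have hV0 : 0 ≤ V := (norm_nonneg _).trans (hV t₀ ⟨by linarith, by linarith⟩)
  set L : ℝ≥0 := ⟨|ℓ⁻¹| * (3 * V), by positivity⟩ with hL
  set a : ℝ≥0 := L * ⟨T, hT.le⟩ with ha
  obtain ⟨K, hK⟩ := auxField_lipschitz v hv ℓ t₀ T a x₀
  have hpl : IsPicardLindelof (auxField v ℓ) (tmin := t₀ - T) (tmax := t₀ + T)
      ⟨t₀, by linarith, by linarith⟩ x₀ a 0 L K :=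
    { lipschitzOnWith := hK
      continuousOn := fun x _ => by
        unfold auxField
        fun_prop
      norm_le := fun t ht x _ => by
        have h1 : ‖(2 * (1 + ‖x‖ ^ 2)⁻¹ * ⟪v t, x⟫) • x‖ ≤ 2 * ‖v t‖ := by
          rw [norm_smul, norm_mul, Real.norm_of_nonneg (by positivity)]
          have h2 := norm_inner_le_norm (𝕜 := ℝ) (v t) x
          calc _ ≤ 2 * (1 + ‖x‖ ^ 2)⁻¹ * (‖v t‖ * ‖x‖) * ‖x‖ := by gcongr
            _ = 2 * ‖v t‖ * (‖x‖ ^ 2 / (1 + ‖x‖ ^ 2)) := by ring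
            _ ≤ 2 * ‖v t‖ * 1 := by
                gcongr
                rw [div_le_one (by positivity)]
                linarith
            _ = _ := mul_one _
        have h3 : ‖-v t + (2 * (1 + ‖x‖ ^ 2)⁻¹ * ⟪v t, x⟫) • x‖ ≤ 3 * V := by
          have := norm_add_le (-v t) ((2 * (1 + ‖x‖ ^ 2)⁻¹ * ⟪v t, x⟫) • x)
          rw [norm_neg] at this
          linarith [hV t ht]
        unfold auxField
        rw [norm_smul, Real.norm_eq_abs]
        exact mul_le_mul_of_nonneg_left h3 (abs_nonneg _)
      mul_max_le := by
        simp only [ha, add_sub_cancel_left, sub_sub_cancel, max_self, NNReal.coe_zero, sub_zero]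
        exact (NNReal.coe_mul L ⟨T, hT.le⟩).ge }
  obtain ⟨r, h0, hr⟩ := hpl.exists_eq_forall_mem_Icc_hasDerivWithinAt₀
  exact ⟨r, h0, fun t ht => (hr t ⟨ht.1.le, ht.2.le⟩).hasDerivAt (Icc_mem_nhds ht.1 ht.2)⟩

theorem norm_auxField_solution (v : ℝ → E3) (hv : Continuous v) (ℓ t₀ T : ℝ) (hT : 0 < T)
    (r : ℝ → E3) (h0 : ‖r t₀‖ = 1)
    (hr : ∀ t ∈ Ioo (t₀ - T) (t₀ + T), HasDerivAt r (auxField v ℓ t (r t)) t) :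
    ∀ t ∈ Ioo (t₀ - T) (t₀ + T), ‖r t‖ = 1 := by
  obtain ⟨V, hV⟩ := (isCompact_Icc (a := t₀ - T) (b := t₀ + T)).exists_bound_of_continuousOn
    hv.continuousOn
  have hV0 : 0 ≤ V := (norm_nonneg _).trans (hV t₀ ⟨by linarith, by linarith⟩)
  set c : ℝ → ℝ := fun t => 2 * ℓ⁻¹ * ⟪v t, r t⟫ * (1 + ‖r t‖ ^ 2)⁻¹ with hc
  have hcb : ∀ t ∈ Ioo (t₀ - T) (t₀ + T), |c t| ≤ |ℓ⁻¹| * V := by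
    intro t ht
    have h1 := norm_inner_le_norm (𝕜 := ℝ) (v t) (r t)
    rw [Real.norm_eq_abs] at h1
    have h2 := hV t ⟨ht.1.le, ht.2.le⟩
    rw [hc]
    simp only [abs_mul, abs_two]
    rw [abs_of_nonneg (a := (1 + ‖r t‖ ^ 2)⁻¹) (by positivity)]
    calc _ ≤ 2 * |ℓ⁻¹| * (V * ‖r t‖) * (1 + ‖r t‖ ^ 2)⁻¹ := by
          gcongr
          exact h1.trans (by gcongr)
      _ = |ℓ⁻¹| * V * (2 * ‖r t‖ / (1 + ‖r t‖ ^ 2)) := by ring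
      _ ≤ |ℓ⁻¹| * V * 1 := by
          gcongr
          rw [div_le_one (by positivity)]
          nlinarith [sq_nonneg (1 - ‖r t‖)]
      _ = _ := mul_one _
  have key : EqOn (fun t => ‖r t‖ ^ 2 - 1) (fun _ => (0 : ℝ)) (Ioo (t₀ - T) (t₀ + T)) := by
    refine ODE_solution_unique_of_mem_Ioo (v := fun t y => c t * y) (s := fun _ => univ)
      (K := Real.toNNReal (|ℓ⁻¹| * V)) (t₀ := t₀) ?_ ⟨by linarith, by linarith⟩ ?_ ?_ ?_
    · intro t ht
      refine LipschitzOnWith.of_dist_le_mul fun x _ y _ => ?_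
      rw [Real.coe_toNNReal _ (by positivity), Real.dist_eq, Real.dist_eq, ← mul_sub, abs_mul]
      exact mul_le_mul_of_nonneg_right (hcb t ht) (abs_nonneg _)
    · intro t ht
      refine ⟨?_, mem_univ _⟩
      have h := ((hr t ht).norm_sq).sub_const 1
      convert h using 1
      simp only [auxField, inner_smul_right, inner_add_right, inner_neg_right,
        real_inner_self_eq_norm_sq, hc, real_inner_comm (v t)]
      field_simp
      ring
    · intro t _
      refine ⟨?_, mem_univ _⟩
      simpa using hasDerivAt_const t (0 : ℝ)
    · simp [h0]
  intro t ht
  have h := key ht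
  simp only at h
  nlinarith [norm_nonneg (r t)]

theorem auxField_of_norm_eq_one (v : ℝ → E3) (ℓ t : ℝ) (x : E3) (hx : ‖x‖ = 1) :
    auxField v ℓ t x = ℓ⁻¹ • (-v t + ⟪v t, x⟫ • x) := by
  rw [auxField, hx]
  norm_num

theorem auxField_unique (v : ℝ → E3) (hv : Continuous v) (ℓ t₀ T : ℝ) (hT : 0 < T)
    (r s : ℝ → E3) (h0 : r t₀ = s t₀)
    (hr : ∀ t ∈ Ioo (t₀ - T) (t₀ + T), HasDerivAt r (auxField v ℓ t (r t)) t ∧ ‖r t‖ = 1)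
    (hs : ∀ t ∈ Ioo (t₀ - T) (t₀ + T), HasDerivAt s (auxField v ℓ t (s t)) t ∧ ‖s t‖ = 1) :
    EqOn r s (Ioo (t₀ - T) (t₀ + T)) := by
  obtain ⟨K, hK⟩ := auxField_lipschitz v hv ℓ t₀ T 1 0
  exact ODE_solution_unique_of_mem_Ioo (v := auxField v ℓ) (s := fun _ => closedBall 0 1)
    (fun t ht => hK t ⟨ht.1.le, ht.2.le⟩) (t₀ := t₀) ⟨by linarith, by linarith⟩
    (fun t ht => ⟨(hr t ht).1, by simp [(hr t ht).2]⟩)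
    (fun t ht => ⟨(hs t ht).1, by simp [(hs t ht).2]⟩) h0

/-- Along a smooth front track the bicycle equation has exactly one solution with a given
initial direction, and it exists for all times. -/
theorem existsUnique_bicycleMotion {Γ : ℝ → E3} (hΓ : ContDiff ℝ ∞ Γ) (ℓ t₀ : ℝ) (x : S2) :
    ∃! r : ℝ → S2, IsBicycleMotion Γ ℓ r ∧ r t₀ = x := by
  have hv : Continuous (deriv Γ) := hΓ.continuous_deriv (by simp)
  have hx : ‖(x : E3)‖ = 1 := by simp
  have hex : ∀ n : ℕ, ∃ r : ℝ → E3, r t₀ = x ∧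
      ∀ t ∈ Ioo (t₀ - (n + 1 : ℝ)) (t₀ + (n + 1 : ℝ)),
        HasDerivAt r (auxField (deriv Γ) ℓ t (r t)) t ∧ ‖r t‖ = 1 := by
    intro n
    obtain ⟨r, h0, hr⟩ := exists_auxField_solution (deriv Γ) hv ℓ t₀ (n + 1) (by positivity) x
    exact ⟨r, h0, fun t ht => ⟨hr t ht,
      norm_auxField_solution (deriv Γ) hv ℓ t₀ (n + 1) (by positivity) r (h0 ▸ hx) hr t ht⟩⟩
  choose R hR0 hR using hex
  have hmem : ∀ (n : ℕ) (t : ℝ), ⌈|t - t₀|⌉₊ ≤ n →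
      t ∈ Ioo (t₀ - (n + 1 : ℝ)) (t₀ + (n + 1 : ℝ)) := by
    intro n t h
    have h1 : |t - t₀| ≤ n := (Nat.le_ceil _).trans (by exact_mod_cast h)
    have h2 := abs_le.mp h1
    exact ⟨by linarith [h2.1], by linarith [h2.2]⟩
  have hmono : ∀ m n : ℕ, m ≤ n → EqOn (R m) (R n) (Ioo (t₀ - (m + 1 : ℝ)) (t₀ + (m + 1 : ℝ))) := by
    intro m n hmn
    have hmn' : (m : ℝ) ≤ n := by exact_mod_cast hmn
    refine auxField_unique (deriv Γ) hv ℓ t₀ (m + 1) (by positivity) _ _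
      ((hR0 m).trans (hR0 n).symm) (hR m) fun t ht => hR n t ?_
    exact ⟨by linarith [ht.1], by linarith [ht.2]⟩
  set r : ℝ → E3 := fun t => R ⌈|t - t₀|⌉₊ t with hrdef
  have hrn : ∀ (n : ℕ) (t : ℝ), ⌈|t - t₀|⌉₊ ≤ n → r t = R n t :=
    fun n t h => hmono _ n h (hmem _ t le_rfl)
  have hrs : ∀ t, ‖r t‖ = 1 := fun t => (hR _ t (hmem _ t le_rfl)).2
  have hrd : ∀ t, HasDerivAt r (auxField (deriv Γ) ℓ t (r t)) t := by
    intro t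
    set n := ⌈|t - t₀|⌉₊ + 1 with hn
    have h1 : r t = R n t := hrn n t (by omega)
    have hd := (hR n t (hmem n t (by omega))).1
    rw [← h1] at hd
    refine hd.congr_of_eventuallyEq ?_
    have hlt : |t - t₀| < n := (Nat.le_ceil _).trans_lt (by exact_mod_cast (by omega))
    have hev : ∀ᶠ s in nhds t, |s - t₀| < n :=
      (by fun_prop : Continuous fun s : ℝ => |s - t₀|).continuousAt.eventually_lt_const hlt
    filter_upwards [hev] with s hs
    exact hrn n s (Nat.ceil_le.mpr hs.le)
  refine ⟨fun t => ⟨r t, by simp [hrs t]⟩, ⟨fun t => ?_, ?_⟩, ?_⟩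
  · have h := hrd t
    rwa [auxField_of_norm_eq_one _ _ _ _ (hrs t)] at h
  · apply Subtype.ext
    exact (hrn 0 t₀ (by simp)).trans (hR0 0)
  · rintro s ⟨hs, hs0⟩
    funext t
    apply Subtype.ext
    have hsn : ∀ t, ‖(s t : E3)‖ = 1 := fun t => by simp
    refine auxField_unique (deriv Γ) hv ℓ t₀ (⌈|t - t₀|⌉₊ + 1) (by positivity)
      (fun t => (s t : E3)) r ?_ (fun t _ => ⟨?_, hsn t⟩) (fun t _ => ⟨hrd t, hrs t⟩)
      (hmem _ t le_rfl)
    · simp only [hs0]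
      exact ((hrn 0 t₀ (by simp)).trans (hR0 0)).symm
    · rw [auxField_of_norm_eq_one _ _ _ _ (hsn t)]
      exact hs t

/-- The solution of the `ℓ`-bicycle equation along `Γ` whose direction at time `t₀` is `x`. -/
noncomputable def bicycleMotion {Γ : ℝ → E3} (hΓ : ContDiff ℝ ∞ Γ) (ℓ t₀ : ℝ) (x : S2) :
    ℝ → S2 :=
  (existsUnique_bicycleMotion hΓ ℓ t₀ x).choose

/-- The `ℓ`-bicycle monodromy `S² → S²` of `Γ` from time `t₀` to time `t₁`: it sends the initial
direction of the bicycle to its final direction. -/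
noncomputable def monodromy {Γ : ℝ → E3} (hΓ : ContDiff ℝ ∞ Γ) (ℓ t₀ t₁ : ℝ) (x : S2) : S2 :=
  bicycleMotion hΓ ℓ t₀ x t₁

/-- The signed length `-∫ r ⬝ v dt`, `v = Γ'`, of the rear track `γ = Γ + ℓ r` over `[t₀, t₁]`.
(Here `γ' = (v ⬝ r) r`, and the front wheel lies in direction `-r` from the rear wheel, so
forward riding is counted positively and backward riding negatively.) -/
noncomputable def signedLength (Γ : ℝ → E3) (r : ℝ → S2) (t₀ t₁ : ℝ) : ℝ :=
  -∫ t in t₀..t₁, ⟪(r t : E3), deriv Γ t⟫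

/-! ### The algebraic area enclosed by a closed spherical curve -/

/-- The winding number around `x` of the closed curve `c : [t₀, t₁] → S² \ {p, x}`, seen in
`S² \ {p}`.  The sphere is oriented by its outward normal, and `S² \ {p}` is identified by
stereographic projection from `p` with the plane `p^⊥`, which is then oriented by the normal `-p`.
With `u` the vector from the image of `x` to the moving image of `c`, the number is
`(2π)⁻¹ ∫ det(u, u') / |u|² dt`, the total turning of `u` divided by `2π`. -/
noncomputable def windingNumber (p : S2) (c : ℝ → S2) (t₀ t₁ : ℝ) (x : S2) : ℝ :=
  (2 * Real.pi)⁻¹ * ∫ t in t₀..t₁,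
    let u : ℝ → E3 := fun s => (stereoToFun (p : E3) (c s : E3) : E3) - stereoToFun (p : E3) (x : E3)
    ⟪cross (u t) (deriv u t), -(p : E3)⟫ / ‖u t‖ ^ 2

/-- The algebraic (signed) area enclosed by the closed curve `c : [t₀, t₁] → S² \ {p}`, when `p`
is regarded as lying outside of `c`: every point of the sphere is counted with the multiplicity
with which `c` winds around it. Another choice of `p` changes it by a multiple of `4π`. -/
noncomputable def algebraicArea (p : S2) (c : ℝ → S2) (t₀ t₁ : ℝ) : ℝ :=
  ∫ x, windingNumber p c t₀ t₁ x ∂(volume : Measure E3).toSphere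

/-! ### Complex numbers as conformal linear maps of tangent planes -/

/-- The complex number `z` acting on the tangent plane `T_x S² = x^⊥ ⊂ ℝ³`, in which
multiplication by `i` is the positive quarter turn `ξ ↦ x × ξ` for the outward normal `x`. -/
noncomputable def tangentMul (x : S2) (z : ℂ) (ξ : E3) : E3 :=
  z.re • ξ + z.im • cross (x : E3) ξ

/-- The differential at `x` of the inclusion of `S²` in `ℝ³`; it identifies the tangent space of
the manifold `S²` at `x` with the plane `x^⊥`. -/
noncomputable def tangentIncl (x : S2) : TangentSpace (𝓡 2) x →L[ℝ] E3 :=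
  mvfderiv (𝓡 2) ((↑) : S2 → E3) x

/-- The map `M : S² → S²` is differentiable at its fixed point `x`, and its derivative there is
multiplication by the complex number `z` on the tangent plane at `x`. -/
def HasComplexDerivAtFixedPoint (M : S2 → S2) (x : S2) (z : ℂ) : Prop :=
  M x = x ∧ MDifferentiableAt (𝓡 2) (𝓡 2) M x ∧
    ∀ ξ : TangentSpace (𝓡 2) x,
      tangentIncl (M x) (mfderiv (𝓡 2) (𝓡 2) M x ξ) = tangentMul x z (tangentIncl x ξ)

end Bicycle

/-!
The bicycle equation is the projectivization of the linear system `ℓ P' = -N v`, `ℓ N' = -⟪v, P⟫`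
on `ℝ³ × ℝ`: if `r` is a motion, then `(N r, N)` solves it for `N = exp (-∫ ⟪v, r⟫ / ℓ)`. Six motions
give a linear propagator (`exists_propagator`), so the monodromy is the restriction to the sphere of
a quotient of affine maps; in particular it is smooth. Its differential at `x` is parallel transport
along the motion that starts at `x`, divided by `N` at the final time (`mfderiv_monodromy`), and this
factor is `exp (-L / ℓ)` (`stretch_inv_eq_exp`).

It remains to show that parallel transport along a closed curve is rotation by the enclosed area.
Let `m = -p`. On the sphere without `p` there is a global orthonormal frame, obtained by rotating a
basis of `m^⊥` along the great circles from `m`. Its connection form is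
`⟪x × dx, m⟫ / (1 + ⟪x, m⟫)`, so the holonomy is the rotation by the integral of this form
(`IsParallel.holonomy`).

The algebraic area is the integral over the sphere of the winding number, that is, of the line
integral of `Im (dz / (z - ζ))` in a stereographic coordinate. The kernel is bounded by the inverse
distance on the sphere, since stereographic projection is expanding, and the inverse distance is
integrable because a cap of chordal radius `ρ` has area `π ρ²` (`toSphere_cap`,
`exists_lintegral_inv_dist_le`). Hence Fubini's theorem applies without regard to the
self-intersections of the curve. The integral of the kernel over `ζ` is found by averaging over the
rotations about `m`: by the mean value property only those `ζ` with `|ζ| < |z|` contribute, each with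
`Im (dz / z)` (`integral_im_div_stereoCoord_sub`). They fill a cap of area `2π (1 - ⟪x, m⟫)`, and
`(1 - ⟪x, m⟫) Im (dz / z)` is exactly the connection form of the frame (`algebraicArea_eq_integral`).
-/

namespace Bicycle

/-! ### The cross product and oriented frames -/

theorem inner_eq_coords (x y : E3) : ⟪x, y⟫ = x 0 * y 0 + x 1 * y 1 + x 2 * y 2 := by
  simp [PiLp.inner_apply, Fin.sum_univ_three, mul_comm]

theorem cross_coord_zero (x y : E3) : cross x y 0 = x 1 * y 2 - x 2 * y 1 := by
  simp [cross, cross_apply]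

theorem cross_coord_one (x y : E3) : cross x y 1 = x 2 * y 0 - x 0 * y 2 := by
  simp [cross, cross_apply]

theorem cross_coord_two (x y : E3) : cross x y 2 = x 0 * y 1 - x 1 * y 0 := by
  simp [cross, cross_apply]

theorem inner_self_cross (x y : E3) : ⟪x, cross x y⟫ = 0 := by
  simp only [inner_eq_coords, cross_coord_zero, cross_coord_one, cross_coord_two]; ring

theorem inner_cross_self (x y : E3) : ⟪y, cross x y⟫ = 0 := by
  simp only [inner_eq_coords, cross_coord_zero, cross_coord_one, cross_coord_two]; ring

/-- The Binet–Cauchy identity. -/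
theorem inner_cross_cross (x y z w : E3) :
    ⟪cross x y, cross z w⟫ = ⟪x, z⟫ * ⟪y, w⟫ - ⟪x, w⟫ * ⟪y, z⟫ := by
  simp only [inner_eq_coords, cross_coord_zero, cross_coord_one, cross_coord_two]; ring

theorem cross_cross_eq (x y z : E3) : cross x (cross y z) = ⟪x, z⟫ • y - ⟪x, y⟫ • z := by
  ext i
  fin_cases i <;>
  simp [inner_eq_coords, cross_coord_zero, cross_coord_one, cross_coord_two] <;> ring

theorem cross_neg_swap (x y : E3) : cross x y = - cross y x := by
  ext i
  fin_cases i <;>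
  simp [cross_coord_zero, cross_coord_one, cross_coord_two] <;> ring

/-- An orthonormal basis of `ℝ³` is positively oriented if its third vector is the cross product
of the first two. -/
def IsPositive (b : OrthonormalBasis (Fin 3) ℝ E3) : Prop := cross (b 0) (b 1) = b 2

/-- Every unit vector is the third vector of a positively oriented orthonormal basis. -/
theorem exists_isPositive (m : E3) (hm : ‖m‖ = 1) :
    ∃ b : OrthonormalBasis (Fin 3) ℝ E3, IsPositive b ∧ b 2 = m := by
  have hmm : ⟪m, m⟫ = 1 := by rw [real_inner_self_eq_norm_sq, hm, one_pow]
  obtain ⟨e, he, hem⟩ : ∃ e : E3, ‖e‖ = 1 ∧ ⟪e, m⟫ = 0 := by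
    have hdim : 0 < Module.finrank ℝ (ℝ ∙ m)ᗮ := by
      have h := Submodule.finrank_add_finrank_orthogonal (𝕜 := ℝ) (ℝ ∙ m)
      have h' := finrank_span_singleton (K := ℝ) (v := m) (by rintro rfl; simp at hm)
      simp only [finrank_euclideanSpace, Fintype.card_fin] at h
      omega
    have := Module.finrank_pos_iff.mp hdim
    obtain ⟨u, hu⟩ := exists_norm_eq (E := (ℝ ∙ m)ᗮ) zero_le_one
    exact ⟨u, by simpa using hu, (Submodule.mem_orthogonal_singleton_iff_inner_left).mp u.2⟩
  have hee : ⟪e, e⟫ = 1 := by rw [real_inner_self_eq_norm_sq, he, one_pow]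
  have hme : ⟪m, e⟫ = 0 := by rw [real_inner_comm, hem]
  have hon : Orthonormal ℝ ![e, cross m e, m] := by
    have hf : ⟪cross m e, cross m e⟫ = 1 := by
      rw [inner_cross_cross, hmm, hee, hme, hem]; norm_num
    rw [orthonormal_iff_ite]
    intro i j
    fin_cases i <;> fin_cases j <;>
      simp [hee, hem, hme, hmm, hf, inner_cross_self, inner_self_cross,
        real_inner_comm e (cross m e), real_inner_comm m (cross m e),
        -inner_self_eq_norm_sq_to_K]
  have hspan : ⊤ ≤ Submodule.span ℝ (Set.range ![e, cross m e, m]) :=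
    (hon.linearIndependent.span_eq_top_of_card_eq_finrank' (by simp)).ge
  refine ⟨OrthonormalBasis.mk hon hspan, ?_, by simp⟩
  simp [IsPositive, cross_cross_eq, hem, he]

section Frame

variable {b : OrthonormalBasis (Fin 3) ℝ E3}

theorem inner_eq_frame (b : OrthonormalBasis (Fin 3) ℝ E3) (x y : E3) :
    ⟪x, y⟫ = ⟪b 0, x⟫ * ⟪b 0, y⟫ + ⟪b 1, x⟫ * ⟪b 1, y⟫ + ⟪b 2, x⟫ * ⟪b 2, y⟫ := by
  rw [← b.sum_inner_mul_inner x y, Fin.sum_univ_three]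
  simp only [real_inner_comm x]

theorem ext_frame (b : OrthonormalBasis (Fin 3) ℝ E3) {x y : E3} (h0 : ⟪b 0, x⟫ = ⟪b 0, y⟫)
    (h1 : ⟪b 1, x⟫ = ⟪b 1, y⟫) (h2 : ⟪b 2, x⟫ = ⟪b 2, y⟫) : x = y := by
  rw [← sub_eq_zero, ← inner_self_eq_zero (𝕜 := ℝ), inner_eq_frame b]
  simp [inner_sub_right, h0, h1, h2]

theorem inner_basis (b : OrthonormalBasis (Fin 3) ℝ E3) (i j : Fin 3) :
    ⟪b i, b j⟫ = if i = j then 1 else 0 := orthonormal_iff_ite.mp b.orthonormal i j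

theorem IsPositive.cross_one_two (hb : IsPositive b) : cross (b 1) (b 2) = b 0 := by
  rw [← hb, cross_cross_eq, inner_basis, inner_basis]; simp

theorem IsPositive.cross_two_zero (hb : IsPositive b) : cross (b 2) (b 0) = b 1 := by
  rw [cross_neg_swap, ← hb, cross_cross_eq, inner_basis, inner_basis]; simp

theorem IsPositive.inner_two_cross (hb : IsPositive b) (x y : E3) :
    ⟪b 2, cross x y⟫ = ⟪b 0, x⟫ * ⟪b 1, y⟫ - ⟪b 1, x⟫ * ⟪b 0, y⟫ := by
  rw [← hb, inner_cross_cross]; ring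

theorem IsPositive.inner_zero_cross (hb : IsPositive b) (x y : E3) :
    ⟪b 0, cross x y⟫ = ⟪b 1, x⟫ * ⟪b 2, y⟫ - ⟪b 2, x⟫ * ⟪b 1, y⟫ := by
  rw [← hb.cross_one_two, inner_cross_cross]; ring

theorem IsPositive.inner_one_cross (hb : IsPositive b) (x y : E3) :
    ⟪b 1, cross x y⟫ = ⟪b 2, x⟫ * ⟪b 0, y⟫ - ⟪b 0, x⟫ * ⟪b 2, y⟫ := by
  rw [← hb.cross_two_zero, inner_cross_cross]; ring

end Frame

/-! ### The linear system above the bicycle equation -/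

/-- The linear system on `ℝ³ × ℝ` of which the bicycle equation is the projectivization: if
`(P, N)` solves it and `|P| = N ≠ 0`, then `P / N` solves the bicycle equation. -/
def IsLinearLift (v : ℝ → E3) (ℓ : ℝ) (P : ℝ → E3) (N : ℝ → ℝ) : Prop :=
  ∀ t, HasDerivAt P (-(ℓ⁻¹ * N t) • v t) t ∧ HasDerivAt N (-(ℓ⁻¹ * ⟪v t, P t⟫)) t

section Lift

variable {v : ℝ → E3} {ℓ : ℝ}

theorem IsLinearLift.add {P Q : ℝ → E3} {N K : ℝ → ℝ} (h : IsLinearLift v ℓ P N)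
    (h' : IsLinearLift v ℓ Q K) : IsLinearLift v ℓ (fun t => P t + Q t) (fun t => N t + K t) := by
  intro t
  refine ⟨((h t).1.add (h' t).1).congr_deriv ?_, ((h t).2.add (h' t).2).congr_deriv ?_⟩
  · module
  · rw [inner_add_right]; ring

theorem IsLinearLift.const_smul {P : ℝ → E3} {N : ℝ → ℝ} (h : IsLinearLift v ℓ P N) (c : ℝ) :
    IsLinearLift v ℓ (fun t => c • P t) (fun t => c * N t) := by
  intro t
  refine ⟨((h t).1.const_smul c).congr_deriv ?_, ((h t).2.const_mul c).congr_deriv ?_⟩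
  · module
  · rw [inner_smul_right]; ring

theorem IsLinearLift.zero : IsLinearLift v ℓ (fun _ => 0) (fun _ => 0) := by
  intro t
  refine ⟨(hasDerivAt_const t _).congr_deriv ?_, (hasDerivAt_const t _).congr_deriv ?_⟩ <;> simp

theorem IsLinearLift.sum {ι : Type*} (s : Finset ι) {P : ι → ℝ → E3} {N : ι → ℝ → ℝ}
    (h : ∀ i, IsLinearLift v ℓ (P i) (N i)) :
    IsLinearLift v ℓ (fun t => ∑ i ∈ s, P i t) (fun t => ∑ i ∈ s, N i t) := by
  classical
  induction s using Finset.induction_on with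
  | empty => simpa using IsLinearLift.zero
  | insert i s hi ih => simpa [Finset.sum_insert hi] using (h i).add ih

/-- Solutions of the linear system are determined by their value at one time. -/
theorem IsLinearLift.unique (hv : Continuous v) {P Q : ℝ → E3} {N K : ℝ → ℝ}
    (h : IsLinearLift v ℓ P N) (h' : IsLinearLift v ℓ Q K) {t₀ : ℝ} (hP : P t₀ = Q t₀)
    (hN : N t₀ = K t₀) (t : ℝ) : P t = Q t ∧ N t = K t := by
  set T := |t - t₀| + 1 with hT
  have hT0 : 0 < T := by positivity
  obtain ⟨V, hV⟩ := (isCompact_Icc (a := t₀ - T) (b := t₀ + T)).exists_bound_of_continuousOn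
    hv.continuousOn
  have hV0 : 0 ≤ V := (norm_nonneg _).trans (hV t₀ ⟨by linarith, by linarith⟩)
  have ht : t ∈ Ioo (t₀ - T) (t₀ + T) := by
    have := abs_lt.mp (show |t - t₀| < T by linarith)
    exact ⟨by linarith [this.1], by linarith [this.2]⟩
  have key : EqOn (fun t => (P t, N t)) (fun t => (Q t, K t)) (Ioo (t₀ - T) (t₀ + T)) := by
    refine ODE_solution_unique_of_mem_Ioo
      (v := fun t (y : E3 × ℝ) => (-(ℓ⁻¹ * y.2) • v t, -(ℓ⁻¹ * ⟪v t, y.1⟫))) (s := fun _ => univ)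
      (K := Real.toNNReal (|ℓ⁻¹| * V)) (t₀ := t₀) ?_ ⟨by linarith, by linarith⟩
      (fun t _ => ⟨(h t).1.prodMk (h t).2, mem_univ _⟩)
      (fun t _ => ⟨(h' t).1.prodMk (h' t).2, mem_univ _⟩) (by simp [hP, hN])
    intro t ht
    have hvt := hV t ⟨ht.1.le, ht.2.le⟩
    refine LipschitzOnWith.of_dist_le_mul fun x _ y _ => ?_
    rw [Real.coe_toNNReal _ (by positivity), dist_eq_norm, dist_eq_norm, Prod.norm_def]
    refine max_le ?_ ?_
    · have e : (-(ℓ⁻¹ * x.2) • v t) - (-(ℓ⁻¹ * y.2) • v t) = -(ℓ⁻¹ * (x - y).2) • v t := by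
        simp only [Prod.snd_sub]; module
      simp only [Prod.fst_sub]
      rw [e, norm_smul, norm_neg, norm_mul, Real.norm_eq_abs ℓ⁻¹, mul_assoc, mul_assoc,
        mul_comm V]
      gcongr
      exact norm_snd_le _
    · have e : -(ℓ⁻¹ * ⟪v t, x.1⟫) - (-(ℓ⁻¹ * ⟪v t, y.1⟫)) = -(ℓ⁻¹ * ⟪v t, (x - y).1⟫) := by
        simp only [Prod.fst_sub, inner_sub_right]; ring
      simp only [Prod.snd_sub]
      rw [e, norm_neg, norm_mul, Real.norm_eq_abs ℓ⁻¹, mul_assoc]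
      gcongr
      refine (norm_inner_le_norm _ _).trans ?_
      gcongr
      exact norm_fst_le _
  have := key ht
  simpa using this

end Lift

section Motion

variable {Γ : ℝ → E3} {ℓ : ℝ}

/-- The second component `N` of the lift `(N r, N)` of the bicycle motion `r` to the linear system,
normalized to be `1` at time `t₀`. -/
noncomputable def stretch (Γ : ℝ → E3) (ℓ t₀ : ℝ) (r : ℝ → S2) (t : ℝ) : ℝ :=
  Real.exp (-∫ s in t₀..t, ℓ⁻¹ * ⟪deriv Γ s, (r s : E3)⟫)

theorem IsBicycleMotion.continuous {r : ℝ → S2} (hr : IsBicycleMotion Γ ℓ r) :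
    Continuous (fun t => (r t : E3)) :=
  continuous_iff_continuousAt.mpr fun t => (hr t).continuousAt

theorem hasDerivAt_stretch (hv : Continuous (deriv Γ)) {r : ℝ → S2} (hr : IsBicycleMotion Γ ℓ r)
    (t₀ t : ℝ) :
    HasDerivAt (stretch Γ ℓ t₀ r)
      (-(ℓ⁻¹ * ⟪deriv Γ t, (r t : E3)⟫) * stretch Γ ℓ t₀ r t) t := by
  have hc : Continuous fun s => ℓ⁻¹ * ⟪deriv Γ s, (r s : E3)⟫ :=
    continuous_const.mul (hv.inner hr.continuous)
  have := ((hc.integral_hasStrictDerivAt t₀ t).hasDerivAt.neg).exp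
  refine this.congr_deriv ?_
  simp only [stretch, Pi.neg_apply]; ring

theorem IsBicycleMotion.isLinearLift (hv : Continuous (deriv Γ)) {r : ℝ → S2}
    (hr : IsBicycleMotion Γ ℓ r) (t₀ : ℝ) :
    IsLinearLift (deriv Γ) ℓ (fun t => stretch Γ ℓ t₀ r t • (r t : E3)) (stretch Γ ℓ t₀ r) := by
  intro t
  have h := hasDerivAt_stretch hv hr t₀ t
  refine ⟨(h.smul (hr t)).congr_deriv ?_, h.congr_deriv ?_⟩
  · module
  · rw [inner_smul_right]; ring

theorem bicycleMotion_spec (hΓ : ContDiff ℝ ∞ Γ) (ℓ t₀ : ℝ) (x : S2) :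
    IsBicycleMotion Γ ℓ (bicycleMotion hΓ ℓ t₀ x) ∧ bicycleMotion hΓ ℓ t₀ x t₀ = x :=
  (existsUnique_bicycleMotion hΓ ℓ t₀ x).choose_spec.1

/-- The linear system has a linear propagator.  Six motions, started at the points `±eᵢ` of the
sphere, are enough to build it, as their lifts span the space of solutions. -/
theorem exists_propagator (hΓ : ContDiff ℝ ∞ Γ) (ℓ t₀ : ℝ) :
    ∃ (L : ℝ → E3 × ℝ →L[ℝ] E3) (l : ℝ → E3 × ℝ →L[ℝ] ℝ),
      (∀ w, IsLinearLift (deriv Γ) ℓ (fun t => L t w) (fun t => l t w)) ∧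
        ∀ w, L t₀ w = w.1 ∧ l t₀ w = w.2 := by
  have hv : Continuous (deriv Γ) := hΓ.continuous_deriv (by simp)
  -- `(y, s) = ∑ (yᵢ / 2 + s / 6) (eᵢ, 1) + (-yᵢ / 2 + s / 6) (-eᵢ, 1)`, with coefficients `f`, `g`
  set e : Fin 3 → S2 := fun i => ⟨EuclideanSpace.single i 1, by simp⟩ with he
  set R : Fin 3 → ℝ → S2 := fun i => bicycleMotion hΓ ℓ t₀ (e i) with hR
  set S : Fin 3 → ℝ → S2 := fun i => bicycleMotion hΓ ℓ t₀ (-e i) with hS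
  set f : Fin 3 → E3 × ℝ →L[ℝ] ℝ := fun i =>
    (1 / 2 : ℝ) • (EuclideanSpace.proj i).comp (.fst ℝ E3 ℝ) + (1 / 6 : ℝ) • .snd ℝ E3 ℝ with hf
  set g : Fin 3 → E3 × ℝ →L[ℝ] ℝ := fun i =>
    (-1 / 2 : ℝ) • (EuclideanSpace.proj i).comp (.fst ℝ E3 ℝ) + (1 / 6 : ℝ) • .snd ℝ E3 ℝ with hg
  have h0 : ∀ r : ℝ → S2, stretch Γ ℓ t₀ r t₀ = 1 := fun r => by simp [stretch]
  refine ⟨fun t => ∑ i, ((f i).smulRight (stretch Γ ℓ t₀ (R i) t • (R i t : E3)) +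
      (g i).smulRight (stretch Γ ℓ t₀ (S i) t • (S i t : E3))),
    fun t => ∑ i, ((f i).smulRight (stretch Γ ℓ t₀ (R i) t) +
      (g i).smulRight (stretch Γ ℓ t₀ (S i) t)), fun w => ?_, fun w => ?_⟩
  · have := IsLinearLift.sum Finset.univ fun i =>
      ((((bicycleMotion_spec hΓ ℓ t₀ (e i)).1).isLinearLift hv t₀).const_smul (f i w)).add
      ((((bicycleMotion_spec hΓ ℓ t₀ (-e i)).1).isLinearLift hv t₀).const_smul (g i w))
    simpa [sum_apply] using this
  · have h1 : ∀ i, R i t₀ = e i := fun i => (bicycleMotion_spec hΓ ℓ t₀ (e i)).2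
    have h2 : ∀ i, S i t₀ = -e i := fun i => (bicycleMotion_spec hΓ ℓ t₀ (-e i)).2
    constructor
    · ext j
      fin_cases j <;>
      simp [h0, h1, h2, Fin.sum_univ_three, f, g, e] <;> ring
    · simp [h0, Fin.sum_univ_three, f, g]; ring

/-- A vector field `ζ` along the bicycle motion `r` which is tangent to the sphere and parallel: its
derivative is normal to the sphere.  The normal component of the derivative is forced to be
`-⟪r', ζ⟫`, and the bicycle equation turns this into the expression used here. -/
structure IsParallel (Γ : ℝ → E3) (ℓ : ℝ) (r : ℝ → S2) (ζ : ℝ → E3) : Prop where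
  hasDerivAt (t : ℝ) : HasDerivAt ζ ((ℓ⁻¹ * ⟪deriv Γ t, ζ t⟫) • (r t : E3)) t
  inner_eq_zero (t : ℝ) : ⟪(r t : E3), ζ t⟫ = 0

/-- If `(X, τ)` solves the linear system and `r` is a bicycle motion, then `X - τ r` is parallel
along `r`, provided that it is tangent to the sphere at one time. -/
theorem IsLinearLift.isParallel (hv : Continuous (deriv Γ)) {r : ℝ → S2}
    (hr : IsBicycleMotion Γ ℓ r) {X : ℝ → E3} {τ : ℝ → ℝ}
    (h : IsLinearLift (deriv Γ) ℓ X τ) {t₀ : ℝ} (h0 : ⟪(r t₀ : E3), X t₀ - τ t₀ • (r t₀ : E3)⟫ = 0) :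
    IsParallel Γ ℓ r (fun t => X t - τ t • (r t : E3)) := by
  have hd : ∀ t, HasDerivAt (fun t => X t - τ t • (r t : E3))
      ((ℓ⁻¹ * ⟪deriv Γ t, X t - τ t • (r t : E3)⟫) • (r t : E3)) t := by
    intro t
    refine ((h t).1.sub ((h t).2.smul (hr t))).congr_deriv ?_
    rw [inner_sub_right, inner_smul_right]
    module
  refine ⟨hd, fun t => ?_⟩
  -- the Lorentz product of the two solutions `(X, τ)` and `(N r, N)`, which is conserved
  set q : ℝ → ℝ := fun t => stretch Γ ℓ t₀ r t * ⟪(r t : E3), X t - τ t • (r t : E3)⟫ with hq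
  have hq' : ∀ t, HasDerivAt q 0 t := by
    intro t
    refine ((hasDerivAt_stretch hv hr t₀ t).mul ((hr t).inner ℝ (hd t))).congr_deriv ?_
    have hrr : ⟪(r t : E3), (r t : E3)⟫ = 1 := by
      rw [real_inner_self_eq_norm_sq]; simp
    simp only [inner_smul_left, inner_smul_right, inner_add_left, inner_neg_left,
      RCLike.conj_to_real, hrr]
    ring
  have hc : q t = q t₀ :=
    is_const_of_deriv_eq_zero (fun t => (hq' t).differentiableAt) (fun t => (hq' t).deriv) t t₀
  have h1 : q t₀ = 0 := by simp only [hq, h0, mul_zero]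
  rw [h1] at hc
  exact (mul_eq_zero.mp hc).resolve_left (Real.exp_pos _).ne'

end Motion

/-! ### The differential of the monodromy -/

section Transport

variable {Γ : ℝ → E3} {ℓ : ℝ}

theorem fact_finrank : Fact (Module.finrank ℝ E3 = 2 + 1) := ⟨by simp⟩

theorem contMDiff_coe : ContMDiff (𝓡 2) 𝓘(ℝ, E3) 1 ((↑) : S2 → E3) :=
  have := fact_finrank
  contMDiff_coe_sphere

theorem mdifferentiableAt_coe_sphere (x : S2) :
    MDifferentiableAt (𝓡 2) 𝓘(ℝ, E3) ((↑) : S2 → E3) x :=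
  (contMDiff_coe x).mdifferentiableAt one_ne_zero

/-- The restriction to the sphere of a smooth map that preserves the sphere is differentiable, and
its differential is the restriction of the ambient one. -/
theorem mdifferentiable_of_extension {M : S2 → S2} {F : E3 → E3}
    (hF : ∀ x : S2, ContDiffAt ℝ 1 F x) (hM : ∀ x : S2, (M x : E3) = F x) (x : S2) :
    MDifferentiableAt (𝓡 2) (𝓡 2) M x ∧ ∀ ξ : TangentSpace (𝓡 2) x,
      tangentIncl (M x) (mfderiv (𝓡 2) (𝓡 2) M x ξ) = fderiv ℝ F x (tangentIncl x ξ) := by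
  have hFM : ContMDiff (𝓡 2) 𝓘(ℝ, E3) 1 (fun x : S2 => F x) := fun x =>
    ContMDiffAt.comp x (hF x).contMDiffAt (contMDiff_coe x)
  have hmem : ∀ x : S2, F x ∈ sphere (0 : E3) 1 := fun x => hM x ▸ (M x).2
  have hMeq : M = Set.codRestrict (fun x : S2 => F x) _ hmem := by
    funext x; exact Subtype.ext (hM x)
  have hMd : MDifferentiableAt (𝓡 2) (𝓡 2) M x := by
    rw [hMeq]
    have := fact_finrank
    exact (hFM.codRestrict_sphere hmem x).mdifferentiableAt one_ne_zero
  refine ⟨hMd, fun ξ => ?_⟩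
  have h1 := mfderiv_comp x (mdifferentiableAt_coe_sphere (M x)) hMd
  have h2 := mfderiv_comp x ((hF x).differentiableAt one_ne_zero).mdifferentiableAt
    (mdifferentiableAt_coe_sphere x)
  have h3 : ((↑) : S2 → E3) ∘ M = F ∘ ((↑) : S2 → E3) := funext hM
  rw [h3, h2, mfderiv_eq_fderiv] at h1
  exact (DFunLike.congr_fun h1 ξ).symm

theorem inner_tangentIncl (x : S2) (ξ : TangentSpace (𝓡 2) x) :
    ⟪(x : E3), tangentIncl x ξ⟫ = 0 := by
  have := fact_finrank
  have h := range_mvfderiv_subtypeVal (n := 2) x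
  have hm : tangentIncl x ξ ∈ (ℝ ∙ (x : E3))ᗮ := by
    rw [← h]; exact ⟨ξ, rfl⟩
  exact Submodule.mem_orthogonal_singleton_iff_inner_right.mp hm

/-- The monodromy is differentiable, and its differential is parallel transport along the motion,
divided by the stretching factor of the linear lift. -/
theorem mfderiv_monodromy (hΓ : ContDiff ℝ ∞ Γ) (ℓ t₀ t₁ : ℝ) (x : S2) :
    MDifferentiableAt (𝓡 2) (𝓡 2) (monodromy hΓ ℓ t₀ t₁) x ∧ ∀ ξ : TangentSpace (𝓡 2) x,
      ∃ ζ : ℝ → E3, IsParallel Γ ℓ (bicycleMotion hΓ ℓ t₀ x) ζ ∧ ζ t₀ = tangentIncl x ξ ∧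
        tangentIncl (monodromy hΓ ℓ t₀ t₁ x)
          (mfderiv (𝓡 2) (𝓡 2) (monodromy hΓ ℓ t₀ t₁) x ξ) =
          (stretch Γ ℓ t₀ (bicycleMotion hΓ ℓ t₀ x) t₁)⁻¹ • ζ t₁ := by
  have hv : Continuous (deriv Γ) := hΓ.continuous_deriv (by simp)
  obtain ⟨L, l, hL, hL0⟩ := exists_propagator hΓ ℓ t₀
  have hlift : ∀ (x : S2) (t : ℝ),
      L t (x, 1) = stretch Γ ℓ t₀ (bicycleMotion hΓ ℓ t₀ x) t • (bicycleMotion hΓ ℓ t₀ x t : E3) ∧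
      l t (x, 1) = stretch Γ ℓ t₀ (bicycleMotion hΓ ℓ t₀ x) t := by
    intro x t
    obtain ⟨h1, h2⟩ := bicycleMotion_spec hΓ ℓ t₀ x
    refine (hL (x, 1)).unique hv (h1.isLinearLift hv t₀) (t₀ := t₀) ?_ ?_ t
    · simp [hL0, h2, stretch]
    · simp [hL0, stretch]
  have hpos : ∀ (x : S2) (t : ℝ), l t (x, 1) ≠ 0 := fun x t => by
    rw [(hlift x t).2]; exact (Real.exp_pos _).ne'
  have hP : ∀ y : E3, HasFDerivAt (fun y : E3 => L t₁ (y, 1)) (L t₁ ∘L .inl ℝ E3 ℝ) y :=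
    fun y => (L t₁).hasFDerivAt.comp y (hasFDerivAt_prodMk_left y 1)
  have hN : ∀ y : E3, HasFDerivAt (fun y : E3 => l t₁ (y, 1)) (l t₁ ∘L .inl ℝ E3 ℝ) y :=
    fun y => (l t₁).hasFDerivAt.comp y (hasFDerivAt_prodMk_left y 1)
  have hPc : ContDiff ℝ 1 (fun y : E3 => L t₁ (y, 1)) := by fun_prop
  have hNc : ContDiff ℝ 1 (fun y : E3 => l t₁ (y, 1)) := by fun_prop
  obtain ⟨hd, hd'⟩ := mdifferentiable_of_extension (M := monodromy hΓ ℓ t₀ t₁)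
    (F := fun y => (l t₁ (y, 1))⁻¹ • L t₁ (y, 1))
    (fun x => (hNc.contDiffAt.inv (hpos x t₁)).smul hPc.contDiffAt)
    (fun x => by
      rw [(hlift x t₁).1, (hlift x t₁).2, smul_smul, inv_mul_cancel₀, one_smul, monodromy]
      exact (Real.exp_pos _).ne') x
  refine ⟨hd, fun ξ => ?_⟩
  set r := bicycleMotion hΓ ℓ t₀ x with hr
  obtain ⟨hr1, hr2⟩ := bicycleMotion_spec hΓ ℓ t₀ x
  set y : E3 := tangentIncl x ξ with hy
  refine ⟨fun t => L t (y, 0) - l t (y, 0) • (r t : E3), (hL (y, 0)).isParallel hv hr1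
    (t₀ := t₀) ?_, ?_, ?_⟩
  · rw [hr2, (hL0 _).1, (hL0 _).2]
    simp [hy, inner_tangentIncl]
  · simp [hL0]
  · rw [hd']
    have hF := ((hasFDerivAt_inv' (hpos x t₁)).comp (x : E3) (hN x)).smul (hP x)
    have hFe := hF.fderiv
    simp only [Function.comp_def] at hFe
    change fderiv ℝ (fun y : E3 => (l t₁ (y, 1))⁻¹ • L t₁ (y, 1)) x y = _
    have hne : stretch Γ ℓ t₀ r t₁ ≠ 0 := (Real.exp_pos _).ne'
    erw [hFe]
    simp [(hlift x t₁).1, (hlift x t₁).2, ← hr]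
    rw [smul_sub, smul_smul, smul_smul, sub_eq_add_neg, ← neg_smul]
    congr 2
    field_simp
    rw [neg_smul]

/-! ### Holonomy in a moving frame -/

/-- Let `m` be the third vector of the basis.  The tangent vector `ζ` at the point `x ≠ -m` of the
sphere, in the frame that is obtained from the first two basis vectors by the rotation which takes
`m` to `x` along a great circle.  The two coordinates are combined into a complex number. -/
noncomputable def frameCoord (b : OrthonormalBasis (Fin 3) ℝ E3) (x ζ : E3) : ℂ :=
  ⟨⟪b 0, ζ⟫ - ⟪b 0, x⟫ * ⟪b 2, ζ⟫ / (1 + ⟪b 2, x⟫), ⟪b 1, ζ⟫ - ⟪b 1, x⟫ * ⟪b 2, ζ⟫ / (1 + ⟪b 2, x⟫)⟩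

/-- The connection form of the frame of `frameCoord`, a primitive of the area form on the sphere
without the point opposite to the third basis vector. -/
noncomputable def areaPrimitive (b : OrthonormalBasis (Fin 3) ℝ E3) (x d : E3) : ℝ :=
  (⟪b 0, x⟫ * ⟪b 1, d⟫ - ⟪b 1, x⟫ * ⟪b 0, d⟫) / (1 + ⟪b 2, x⟫)

/-- In the moving frame, a parallel vector field rotates with the speed given by the connection
form. -/
theorem hasDerivAt_frameCoord (b : OrthonormalBasis (Fin 3) ℝ E3) {r : ℝ → S2} {ζ : ℝ → E3}
    (hr : IsBicycleMotion Γ ℓ r) (hζ : IsParallel Γ ℓ r ζ) {t : ℝ}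
    (hD : 1 + ⟪b 2, (r t : E3)⟫ ≠ 0) :
    HasDerivAt (fun s => frameCoord b (r s) (ζ s))
      (Complex.I * areaPrimitive b (r t) (deriv (fun s => (r s : E3)) t) *
        frameCoord b (r t) (ζ t)) t := by
  have hrt := (hr t).differentiableAt.hasDerivAt
  set d := deriv (fun s => (r s : E3)) t with hd
  set k := ℓ⁻¹ * ⟪deriv Γ t, ζ t⟫ with hk
  have hk' : k = -⟪d, ζ t⟫ := by
    rw [hd, (hr t).deriv, inner_smul_left, inner_add_left, inner_neg_left, inner_smul_left,
      hζ.inner_eq_zero t]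
    simp [hk]
  have hxx : ⟪(r t : E3), (r t : E3)⟫ = 1 := by
    rw [real_inner_self_eq_norm_sq]; simp
  have hxd : ⟪(r t : E3), d⟫ = 0 := by
    rw [hd, (hr t).deriv, inner_smul_right, inner_add_right, inner_neg_right, inner_smul_right,
      hxx, real_inner_comm]
    simp
  have hxz := hζ.inner_eq_zero t
  rw [inner_eq_frame b] at hxx hxd hxz hk'
  have hz := hζ.hasDerivAt t
  have hx : ∀ i, HasDerivAt (fun s => ⟪b i, (r s : E3)⟫) ⟪b i, d⟫ t := fun i => by
    simpa using (hasDerivAt_const t (b i)).inner ℝ hrt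
  have hzz : ∀ i, HasDerivAt (fun s => ⟪b i, ζ s⟫) (k * ⟪b i, (r t : E3)⟫) t := fun i => by
    simpa [inner_smul_right] using (hasDerivAt_const t (b i)).inner ℝ hz
  have hg : ∀ i, HasDerivAt
      (fun s => ⟪b i, ζ s⟫ - ⟪b i, (r s : E3)⟫ * ⟪b 2, ζ s⟫ / (1 + ⟪b 2, (r s : E3)⟫))
      (k * ⟪b i, (r t : E3)⟫ - ((⟪b i, d⟫ * ⟪b 2, ζ t⟫ +
        ⟪b i, (r t : E3)⟫ * (k * ⟪b 2, (r t : E3)⟫)) * (1 + ⟪b 2, (r t : E3)⟫) -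
        ⟪b i, (r t : E3)⟫ * ⟪b 2, ζ t⟫ * ⟪b 2, d⟫) / (1 + ⟪b 2, (r t : E3)⟫) ^ 2) t :=
    fun i => (hzz i).sub (((hx i).mul (hzz 2)).div ((hx 2).const_add 1) hD)
  have h0 := (hg 0).ofReal_comp.add ((hg 1).ofReal_comp.mul_const Complex.I)
  have e : (fun s => frameCoord b (r s) (ζ s)) = fun s =>
      (((⟪b 0, ζ s⟫ - ⟪b 0, (r s : E3)⟫ * ⟪b 2, ζ s⟫ / (1 + ⟪b 2, (r s : E3)⟫) : ℝ) : ℂ)) +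
      (((⟪b 1, ζ s⟫ - ⟪b 1, (r s : E3)⟫ * ⟪b 2, ζ s⟫ / (1 + ⟪b 2, (r s : E3)⟫) : ℝ) : ℂ)) *
        Complex.I := by
    funext s
    exact Complex.mk_eq_add_mul_I _ _
  rw [e]
  refine h0.congr_deriv ?_
  simp only [frameCoord, areaPrimitive]
  rw [hk']
  generalize ⟪b 0, (r t : E3)⟫ = x0 at *
  generalize ⟪b 1, (r t : E3)⟫ = x1 at *
  generalize ⟪b 2, (r t : E3)⟫ = x2 at *
  generalize ⟪b 0, d⟫ = d0 at *
  generalize ⟪b 1, d⟫ = d1 at *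
  generalize ⟪b 2, d⟫ = d2 at *
  generalize ⟪b 0, ζ t⟫ = z0 at *
  generalize ⟪b 1, ζ t⟫ = z1 at *
  generalize ⟪b 2, ζ t⟫ = z2 at *
  have hA : -(d0 * z0 + d1 * z1 + d2 * z2) * x0 -
      ((d0 * z2 + x0 * (-(d0 * z0 + d1 * z1 + d2 * z2) * x2)) * (1 + x2) - x0 * z2 * d2) /
        (1 + x2) ^ 2 = -((x0 * d1 - x1 * d0) / (1 + x2)) * (z1 - x1 * z2 / (1 + x2)) := by
    field_simp
    linear_combination (-(1 + x2) * d0) * hxz + d0 * z2 * hxx - z2 * x0 * hxd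
  have hB : -(d0 * z0 + d1 * z1 + d2 * z2) * x1 -
      ((d1 * z2 + x1 * (-(d0 * z0 + d1 * z1 + d2 * z2) * x2)) * (1 + x2) - x1 * z2 * d2) /
        (1 + x2) ^ 2 = ((x0 * d1 - x1 * d0) / (1 + x2)) * (z0 - x0 * z2 / (1 + x2)) := by
    field_simp
    linear_combination (-(1 + x2) * d1) * hxz + d1 * z2 * hxx - z2 * x1 * hxd
  rw [hA, hB, Complex.mk_eq_add_mul_I]
  push_cast
  linear_combination (-((x0 * d1 - x1 * d0) / (1 + x2)) * (z1 - x1 * z2 / (1 + x2)) : ℂ) *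
    Complex.I_sq

/-- The moving frame is positively oriented: the quarter turn is multiplication by `i`. -/
theorem frameCoord_cross {b : OrthonormalBasis (Fin 3) ℝ E3} (hb : IsPositive b) {x ζ : E3}
    (hx : ‖x‖ = 1) (hζ : ⟪x, ζ⟫ = 0) (hD : 1 + ⟪b 2, x⟫ ≠ 0) :
    frameCoord b x (cross x ζ) = Complex.I * frameCoord b x ζ := by
  have hxx : ⟪x, x⟫ = 1 := by rw [real_inner_self_eq_norm_sq, hx, one_pow]
  rw [inner_eq_frame b] at hxx hζ
  simp only [frameCoord, hb.inner_zero_cross, hb.inner_one_cross, hb.inner_two_cross]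
  generalize ⟪b 0, x⟫ = x0 at *
  generalize ⟪b 1, x⟫ = x1 at *
  generalize ⟪b 2, x⟫ = x2 at *
  generalize ⟪b 0, ζ⟫ = z0 at *
  generalize ⟪b 1, ζ⟫ = z1 at *
  generalize ⟪b 2, ζ⟫ = z2 at *
  apply Complex.ext
  · simp
    field_simp
    linear_combination x1 * hζ - z1 * hxx
  · simp
    field_simp
    linear_combination -x0 * hζ + z0 * hxx

theorem frameCoord_injective (b : OrthonormalBasis (Fin 3) ℝ E3) {x ζ η : E3}
    (hx : ‖x‖ = 1) (hζ : ⟪x, ζ⟫ = 0) (hη : ⟪x, η⟫ = 0) (hD : 1 + ⟪b 2, x⟫ ≠ 0)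
    (h : frameCoord b x ζ = frameCoord b x η) : ζ = η := by
  have hxx : ⟪x, x⟫ = 1 := by rw [real_inner_self_eq_norm_sq, hx, one_pow]
  rw [inner_eq_frame b] at hxx hζ hη
  obtain ⟨h0, h1⟩ := Complex.ext_iff.mp h
  simp only [frameCoord] at h0 h1
  have h2 : ⟪b 2, ζ⟫ = ⟪b 2, η⟫ := by
    field_simp at h0 h1
    have : (⟪b 2, ζ⟫ - ⟪b 2, η⟫) * (1 + ⟪b 2, x⟫) = 0 := by
      linear_combination (1 + ⟪b 2, x⟫) * hζ - (1 + ⟪b 2, x⟫) * hη - ⟪b 0, x⟫ * h0 - ⟪b 1, x⟫ * h1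
        - (⟪b 2, ζ⟫ - ⟪b 2, η⟫) * hxx
    exact sub_eq_zero.mp ((mul_eq_zero.mp this).resolve_right hD)
  rw [h2] at h0 h1
  exact ext_frame b (by linarith) (by linarith) h2

theorem eq_exp_integral_mul {z : ℝ → ℂ} {f : ℝ → ℝ} {t₀ t₁ : ℝ} (ht : t₀ ≤ t₁)
    (hf : ContinuousOn f (Icc t₀ t₁))
    (hz : ∀ t ∈ Icc t₀ t₁, HasDerivAt z (Complex.I * f t * z t) t) :
    z t₁ = Complex.exp (Complex.I * ((∫ t in t₀..t₁, f t : ℝ) : ℂ)) * z t₀ := by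
  -- a continuous extension of `f` makes its primitive differentiable at the end points as well
  set w : ℝ → ℝ := IccExtend ht ((Icc t₀ t₁).domRestrict f) with hw
  have hwc : Continuous w := hf.domRestrict.Icc_extend'
  have hwe : ∀ t ∈ Icc t₀ t₁, w t = f t := fun t h => by
    rw [hw, IccExtend_of_mem ht _ h]; rfl
  set θ : ℝ → ℝ := fun t => ∫ s in t₀..t, w s with hθ
  have hθd : ∀ t, HasDerivAt θ (w t) t := fun t =>
    (hwc.integral_hasStrictDerivAt t₀ t).hasDerivAt
  have hF : ∀ t ∈ Icc t₀ t₁,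
      HasDerivAt (fun t => Complex.exp (-(Complex.I * (θ t : ℂ))) * z t) 0 t := by
    intro t ht'
    have h1 := ((((hθd t).ofReal_comp).const_mul Complex.I).neg.cexp).mul (hz t ht')
    refine h1.congr_deriv ?_
    rw [hwe t ht']
    simp only [Pi.neg_apply]
    ring
  have hc := constant_of_has_deriv_right_zero
    (f := fun t => Complex.exp (-(Complex.I * (θ t : ℂ))) * z t) (a := t₀) (b := t₁)
    (fun t h => (hF t h).continuousAt.continuousWithinAt)
    (fun t h => (hF t ⟨h.1, h.2.le⟩).hasDerivWithinAt) t₁ ⟨ht, le_rfl⟩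
  have h0 : θ t₀ = 0 := by simp [hθ]
  have h1 : θ t₁ = ∫ t in t₀..t₁, f t :=
    intervalIntegral.integral_congr fun t h => hwe t (by rwa [uIcc_of_le ht] at h)
  simp only [h0, h1] at hc
  rw [Complex.exp_neg, inv_mul_eq_iff_eq_mul₀ (Complex.exp_ne_zero _)] at hc
  simpa using hc

theorem continuousOn_areaPrimitive (b : OrthonormalBasis (Fin 3) ℝ E3)
    (hΓ : ContDiff ℝ ∞ Γ) {r : ℝ → S2} (hr : IsBicycleMotion Γ ℓ r) {s : Set ℝ}
    (hD : ∀ t ∈ s, 1 + ⟪b 2, (r t : E3)⟫ ≠ 0) :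
    ContinuousOn (fun t => areaPrimitive b (r t) (deriv (fun s => (r s : E3)) t)) s := by
  have hv : Continuous (deriv Γ) := hΓ.continuous_deriv (by simp)
  have hrc := hr.continuous
  have hd : Continuous (deriv (fun s => (r s : E3))) := by
    rw [funext fun t => (hr t).deriv]
    fun_prop
  unfold areaPrimitive
  have hri : ∀ i, Continuous fun t => ⟪b i, (r t : E3)⟫ := fun i => continuous_const.inner hrc
  exact ContinuousOn.div (by fun_prop) (continuous_const.add (hri 2)).continuousOn hD

/-- The holonomy of a closed curve on the sphere is the rotation by the integral of a primitive of
the area form. -/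
theorem IsParallel.holonomy {b : OrthonormalBasis (Fin 3) ℝ E3} (hb : IsPositive b)
    (hΓ : ContDiff ℝ ∞ Γ) {r : ℝ → S2}
    {ζ : ℝ → E3} (hr : IsBicycleMotion Γ ℓ r) (hζ : IsParallel Γ ℓ r ζ) {t₀ t₁ : ℝ} (ht : t₀ ≤ t₁)
    (hD : ∀ t ∈ Icc t₀ t₁, 1 + ⟪b 2, (r t : E3)⟫ ≠ 0) (hclosed : r t₁ = r t₀) :
    ζ t₁ = tangentMul (r t₀) (Complex.exp (Complex.I * ((∫ t in t₀..t₁,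
      areaPrimitive b (r t) (deriv (fun s => (r s : E3)) t) : ℝ) : ℂ))) (ζ t₀) := by
  have h := eq_exp_integral_mul ht (continuousOn_areaPrimitive b hΓ hr hD)
    (fun t h => hasDerivAt_frameCoord b hr hζ (hD t h))
  have h0 : ⟪(r t₀ : E3), ζ t₀⟫ = 0 := hζ.inner_eq_zero t₀
  have h1 : ⟪(r t₀ : E3), ζ t₁⟫ = 0 := hclosed ▸ hζ.inner_eq_zero t₁
  have hn : ‖(r t₀ : E3)‖ = 1 := by simp
  have hD0 := hD t₀ ⟨le_rfl, ht⟩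
  rw [hclosed] at h
  refine frameCoord_injective b hn h1 ?_ hD0 ?_
  · simp [tangentMul, inner_add_right, inner_smul_right, h0, inner_self_cross]
  · rw [h]
    generalize Complex.exp _ = w
    have hlin : ∀ (a c : ℝ) (ξ η : E3), frameCoord b (r t₀) (a • ξ + c • η) =
        a * frameCoord b (r t₀) ξ + c * frameCoord b (r t₀) η := by
      intro a c ξ η
      apply Complex.ext <;> simp [frameCoord, inner_add_right, inner_smul_right] <;> ring
    rw [tangentMul, hlin, frameCoord_cross hb hn h0 hD0]
    conv_lhs => rw [← Complex.re_add_im w]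
    ring

end Transport

/-! ### The area of spherical caps -/

section Cap

open scoped Pointwise

/-- Linear isometries preserve the area of the sphere. -/
theorem measurePreserving_sphere (R : E3 ≃ₗᵢ[ℝ] E3) (f : S2 → S2) (hf : ∀ x, (f x : E3) = R x) :
    MeasurePreserving f (volume : Measure E3).toSphere (volume : Measure E3).toSphere := by
  have hfc : Continuous f := by
    refine continuous_induced_rng.mpr ?_
    rw [show Subtype.val ∘ f = fun x : S2 => R x from funext hf]
    exact R.continuous.comp continuous_subtype_val
  refine ⟨hfc.measurable, ?_⟩
  ext s hs
  rw [Measure.map_apply hfc.measurable hs, Measure.toSphere_apply' _ hs,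
    Measure.toSphere_apply' _ (hfc.measurable hs)]
  congr 1
  have e : Ioo (0 : ℝ) 1 • ((↑) '' (f ⁻¹' s) : Set E3) =
      R ⁻¹' (Ioo (0 : ℝ) 1 • ((↑) '' s : Set E3)) := by
    ext y
    simp only [Set.mem_smul, mem_preimage, mem_image]
    constructor
    · rintro ⟨a, ha, _, ⟨x, hx, rfl⟩, rfl⟩
      exact ⟨a, ha, _, ⟨f x, hx, rfl⟩, by rw [hf, map_smul]⟩
    · rintro ⟨a, ha, _, ⟨x, hx, rfl⟩, hy⟩
      have hn : R.symm (x : E3) ∈ sphere (0 : E3) 1 := by simp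
      refine ⟨a, ha, _, ⟨⟨R.symm x, hn⟩, ?_, rfl⟩, ?_⟩
      · have : f ⟨R.symm x, hn⟩ = x := Subtype.ext (by simp [hf])
        rwa [this]
      · apply R.injective
        rw [← hy, map_smul]; simp
  rw [e]
  exact R.measurePreserving.measure_preimage_emb R.toHomeomorph.measurableEmbedding _

/-- The coordinates `(z, w) ↦ w₀ b₀ + w₁ b₁ + z b₂` preserve the volume. -/
theorem exists_cylindrical (b : OrthonormalBasis (Fin 3) ℝ E3) :
    ∃ Ψ : ℝ × EuclideanSpace ℝ (Fin 2) → E3, MeasurePreserving Ψ ∧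
      ∀ q, ⟪b 2, Ψ q⟫ = q.1 ∧ ‖Ψ q‖ ^ 2 = q.1 ^ 2 + ‖q.2‖ ^ 2 := by
  refine ⟨_, b.measurePreserving_repr_symm.comp ((PiLp.volume_preserving_toLp (Fin 3)).comp
    ((volume_preserving_piFinSuccAbove (fun _ => ℝ) 2).symm.comp
      ((MeasurePreserving.id volume).prod (PiLp.volume_preserving_ofLp (Fin 2))))), fun q => ?_⟩
  obtain ⟨z, w⟩ := q
  have h1 : ∀ i, ⟪b i, b.repr.symm (WithLp.toLp 2 (Fin.insertNth (α := fun _ => ℝ) 2 z w))⟫ =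
      Fin.insertNth (α := fun _ => ℝ) 2 z w i := by
    intro i
    rw [← b.repr_apply_apply]; simp
  have h0 : (Fin.insertNth (α := fun _ => ℝ) 2 z w : Fin 3 → ℝ) 0 = w 0 :=
    Fin.insertNth_apply_succAbove (α := fun _ : Fin 3 => ℝ) 2 z w 0
  have h0' : (Fin.insertNth (α := fun _ => ℝ) 2 z w : Fin 3 → ℝ) 1 = w 1 :=
    Fin.insertNth_apply_succAbove (α := fun _ : Fin 3 => ℝ) 2 z w 1
  constructor
  · exact (h1 2).trans (by simp)
  · change ‖b.repr.symm (WithLp.toLp 2 (Fin.insertNth (α := fun _ => ℝ) 2 z w))‖ ^ 2 = _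
    rw [b.repr.symm.norm_map, EuclideanSpace.norm_sq_eq, EuclideanSpace.norm_sq_eq,
      Fin.sum_univ_three, Fin.sum_univ_two]
    simp only [h0, h0', Fin.insertNth_apply_same, Real.norm_eq_abs, sq_abs]
    ring

/-- The volume of a spherical sector, by integration of the areas of its slices at the heights
`z = ⟪b 2, y⟫`.  Membership of the boundary points is left open. -/
theorem volume_sector_of_measurableSet (b : OrthonormalBasis (Fin 3) ℝ E3) {h : ℝ} (h0 : 0 < h)
    (h1 : h ≤ 1)
    {T : Set E3} (hT : MeasurableSet T) (hlow : ∀ y, ‖y‖ < 1 → h * ‖y‖ < ⟪b 2, y⟫ → y ∈ T)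
    (hup : ∀ y ∈ T, ‖y‖ ≤ 1 ∧ h * ‖y‖ ≤ ⟪b 2, y⟫) :
    volume T = ENNReal.ofReal (2 * Real.pi / 3 * (1 - h)) := by
  obtain ⟨Ψ, hΨ, hΨ'⟩ := exists_cylindrical b
  -- the slice at height `z` is a disc: up to `z = h` it is bounded by the cone, of squared radius
  -- `c z ^ 2`, and from there on by the unit sphere
  set c : ℝ := (1 - h ^ 2) / h ^ 2 with hc
  have hc0 : 0 ≤ c := div_nonneg (by nlinarith) (by positivity)
  have hch : h ^ 2 * c = 1 - h ^ 2 := by rw [hc]; field_simp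
  set g : ℝ → ℝ := fun z => Real.pi * min (1 - z ^ 2) (c * z ^ 2) with hg
  rw [← hΨ.measure_preimage hT.nullMeasurableSet, Measure.volume_eq_prod,
    Measure.prod_apply (hΨ.measurable hT)]
  have hslice : ∀ᵐ z : ℝ, volume (Prod.mk z ⁻¹' (Ψ ⁻¹' T)) =
      (Ioc (0 : ℝ) 1).indicator (fun z => ENNReal.ofReal (g z)) z := by
    have hne : ∀ᵐ z : ℝ, z ≠ 0 := by simp [ae_iff]
    filter_upwards [hne] with z hz
    by_cases hz1 : z ∈ Ioc (0 : ℝ) 1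
    · rw [indicator_of_mem hz1]
      have hm0 : 0 ≤ min (1 - z ^ 2) (c * z ^ 2) := by
        refine le_min ?_ (by positivity)
        nlinarith [hz1.1, hz1.2]
      have hball : ENNReal.ofReal (√(min (1 - z ^ 2) (c * z ^ 2))) ^ 2 * ENNReal.ofReal Real.pi =
          ENNReal.ofReal (g z) := by
        rw [← ENNReal.ofReal_pow (Real.sqrt_nonneg _), Real.sq_sqrt hm0,
          ← ENNReal.ofReal_mul hm0, mul_comm]
      apply le_antisymm
      · rw [← hball, ← EuclideanSpace.volume_closedBall_fin_two 0]
        refine measure_mono fun w hw => ?_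
        obtain ⟨h2, h3⟩ := hup _ hw
        obtain ⟨e1, e2⟩ := hΨ' (z, w)
        rw [e1] at h3
        simp only at e2 h3
        rw [mem_closedBall_zero_iff]
        refine Real.le_sqrt_of_sq_le (le_min ?_ ?_)
        · nlinarith [norm_nonneg (Ψ (z, w))]
        · have h4 : (h * ‖Ψ (z, w)‖) ^ 2 ≤ z ^ 2 := by gcongr
          rw [mul_pow, e2] at h4
          have : h ^ 2 * ‖w‖ ^ 2 ≤ h ^ 2 * (c * z ^ 2) := by
            rw [← mul_assoc, hch]; linarith
          exact le_of_mul_le_mul_left this (by positivity)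
      · rw [← hball, ← EuclideanSpace.volume_ball_fin_two 0]
        refine measure_mono fun w hw => ?_
        obtain ⟨e1, e2⟩ := hΨ' (z, w)
        rw [mem_ball_zero_iff, Real.lt_sqrt (norm_nonneg _), lt_min_iff] at hw
        simp only at e1 e2
        refine hlow _ ?_ ?_
        · nlinarith [norm_nonneg (Ψ (z, w))]
        · rw [e1]
          refine lt_of_pow_lt_pow_left₀ 2 hz1.1.le ?_
          rw [mul_pow, e2]
          have : h ^ 2 * ‖w‖ ^ 2 < h ^ 2 * (c * z ^ 2) := by
            gcongr; exact hw.2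
          rw [← mul_assoc, hch] at this
          linarith
    · rw [indicator_of_notMem hz1]
      convert measure_empty (μ := volume)
      refine eq_empty_of_forall_notMem fun w hw => hz1 ?_
      obtain ⟨h2, h3⟩ := hup _ hw
      obtain ⟨e1, e2⟩ := hΨ' (z, w)
      rw [e1] at h3
      simp only at e2 h3
      have h4 : 0 ≤ z := (mul_nonneg h0.le (norm_nonneg _)).trans h3
      exact ⟨lt_of_le_of_ne h4 hz.symm, by nlinarith [norm_nonneg (Ψ (z, w)), sq_nonneg ‖w‖]⟩
  have hgc : Continuous g := by fun_prop
  rw [lintegral_congr_ae hslice, lintegral_indicator measurableSet_Ioc,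
    ← ofReal_integral_eq_lintegral_ofReal hgc.integrableOn_Ioc]
  · rw [← intervalIntegral.integral_of_le zero_le_one,
      ← intervalIntegral.integral_add_adjacent_intervals (b := h)
        (hgc.intervalIntegrable _ _) (hgc.intervalIntegrable _ _)]
    have i1 : ∫ z in (0 : ℝ)..h, g z = ∫ z in (0 : ℝ)..h, Real.pi * (c * z ^ 2) := by
      refine intervalIntegral.integral_congr fun z hz => ?_
      rw [uIcc_of_le h0.le] at hz
      have : z ^ 2 ≤ h ^ 2 := by nlinarith [hz.1, hz.2]
      simp only [hg]
      rw [min_eq_right]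
      nlinarith
    have i2 : ∫ z in h..1, g z = ∫ z in h..1, Real.pi * (1 - z ^ 2) := by
      refine intervalIntegral.integral_congr fun z hz => ?_
      rw [uIcc_of_le h1] at hz
      have : h ^ 2 ≤ z ^ 2 := by nlinarith [hz.1, hz.2]
      simp only [hg]
      rw [min_eq_left]
      nlinarith
    rw [i1, i2]
    congr 1
    simp only [intervalIntegral.integral_const_mul]
    rw [intervalIntegral.integral_sub (by simp) (by simp)]
    simp only [integral_pow, intervalIntegral.integral_const]
    norm_num
    rw [show c = (1 - h ^ 2) / h ^ 2 from rfl]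
    field_simp
    ring
  · refine (ae_restrict_iff' measurableSet_Ioc).mpr (.of_forall fun z hz => ?_)
    refine mul_nonneg Real.pi_pos.le (le_min ?_ (by positivity))
    nlinarith [hz.1, hz.2]

theorem volume_sector (b : OrthonormalBasis (Fin 3) ℝ E3) {h : ℝ} (h0 : 0 < h) (h1 : h ≤ 1)
    {T : Set E3} (hlow : ∀ y, ‖y‖ < 1 → h * ‖y‖ < ⟪b 2, y⟫ → y ∈ T)
    (hup : ∀ y ∈ T, ‖y‖ ≤ 1 ∧ h * ‖y‖ ≤ ⟪b 2, y⟫) :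
    volume T = ENNReal.ofReal (2 * Real.pi / 3 * (1 - h)) := by
  apply le_antisymm
  · rw [← volume_sector_of_measurableSet b h0 h1 (T := {y | ‖y‖ ≤ 1 ∧ h * ‖y‖ ≤ ⟪b 2, y⟫})
      (by measurability) (fun y h2 h3 => ⟨h2.le, h3.le⟩) (fun y hy => hy)]
    exact measure_mono hup
  · rw [← volume_sector_of_measurableSet b h0 h1 (T := {y | ‖y‖ < 1 ∧ h * ‖y‖ < ⟪b 2, y⟫})
      (by measurability) (fun y h2 h3 => ⟨h2, h3⟩) (fun y hy => ⟨hy.1.le, hy.2.le⟩)]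
    exact measure_mono fun y hy => hlow y hy.1 hy.2

theorem toSphere_univ : (volume : Measure E3).toSphere univ = ENNReal.ofReal (4 * Real.pi) := by
  rw [Measure.toSphere_apply_univ, EuclideanSpace.volume_ball_fin_three]
  simp only [finrank_euclideanSpace, Fintype.card_fin, ENNReal.ofReal_one, one_pow, one_mul]
  rw [← ENNReal.ofReal_natCast, ← ENNReal.ofReal_mul (by norm_num)]
  congr 1
  push_cast; ring

theorem toSphere_cap_of_pos (m : S2) {h : ℝ} (h0 : 0 < h) (h1 : h ≤ 1) {s : Set S2}
    (hs : MeasurableSet s)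
    (hlow : ∀ x : S2, h < ⟪(m : E3), (x : E3)⟫ → x ∈ s) (hup : ∀ x ∈ s, h ≤ ⟪(m : E3), (x : E3)⟫) :
    (volume : Measure E3).toSphere s = ENNReal.ofReal (2 * Real.pi * (1 - h)) := by
  obtain ⟨b, -, hb⟩ := exists_isPositive m (by simp)
  rw [Measure.toSphere_apply' _ hs, volume_sector b h0 h1]
  · simp only [finrank_euclideanSpace, Fintype.card_fin]
    rw [← ENNReal.ofReal_natCast, ← ENNReal.ofReal_mul (by norm_num)]
    congr 1
    push_cast; ring
  · intro y hy hym
    rw [hb] at hym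
    have hy0 : y ≠ 0 := by rintro rfl; simp at hym
    have hyn : 0 < ‖y‖ := norm_pos_iff.mpr hy0
    have hmem : ‖y‖⁻¹ • y ∈ sphere (0 : E3) 1 := by
      simp [norm_smul, hyn.ne']
    refine Set.mem_smul.mpr ⟨‖y‖, ⟨hyn, hy⟩, _, ⟨⟨_, hmem⟩, hlow _ ?_, rfl⟩, ?_⟩
    · rw [inner_smul_right, ← div_eq_inv_mul, lt_div_iff₀ hyn]
      exact hym
    · exact smul_inv_smul₀ hyn.ne' y
  · rintro y hy
    obtain ⟨a, ha, _, ⟨x, hx, rfl⟩, rfl⟩ := Set.mem_smul.mp hy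
    have hxn : ‖(x : E3)‖ = 1 := by simp
    rw [hb, norm_smul, hxn, Real.norm_of_nonneg ha.1.le, inner_smul_right]
    exact ⟨by linarith [ha.2], by nlinarith [hup x hx, ha.1]⟩

theorem measurableSet_cap (m : S2) (h : ℝ) : MeasurableSet {x : S2 | h < ⟪(m : E3), (x : E3)⟫} :=
  measurableSet_lt measurable_const (by fun_prop)

/-- A cap larger than a hemisphere is the complement of a smaller one. -/
theorem toSphere_cap_of_neg (m : S2) {h : ℝ} (h0 : -1 ≤ h) (h1 : h < 0) :
    (volume : Measure E3).toSphere {x : S2 | h < ⟪(m : E3), (x : E3)⟫} =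
      ENNReal.ofReal (2 * Real.pi * (1 - h)) := by
  have hm := measurableSet_cap m h
  have hc := toSphere_cap_of_pos (-m) (h := -h) (by linarith) (by linarith) hm.compl
    (by intro x hx; simp at hx ⊢; linarith) (by intro x hx; simp at hx ⊢; linarith)
  rw [← compl_compl {x : S2 | h < ⟪(m : E3), (x : E3)⟫}, measure_compl hm.compl (measure_ne_top _ _),
    hc, toSphere_univ, ← ENNReal.ofReal_sub _ (by nlinarith [Real.pi_pos])]
  congr 1; ring

/-- Archimedes: the area of a spherical cap is proportional to its height. -/
theorem toSphere_cap (m : S2) {h : ℝ} (h0 : -1 ≤ h) (h1 : h ≤ 1) :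
    (volume : Measure E3).toSphere {x : S2 | h < ⟪(m : E3), (x : E3)⟫} =
      ENNReal.ofReal (2 * Real.pi * (1 - h)) := by
  rcases lt_trichotomy h 0 with hh | rfl | hh
  · exact toSphere_cap_of_neg m h0 hh
  -- squeeze the open hemisphere between caps on either side of the equator
  · have hup : ∀ ε : ℝ, 0 < ε → ε ≤ 1 → (volume : Measure E3).toSphere
        {x : S2 | 0 < ⟪(m : E3), (x : E3)⟫} ≤ ENNReal.ofReal (2 * Real.pi * (1 + ε)) := by
      intro ε h2 h3
      rw [show 1 + ε = 1 - -ε by ring, ← toSphere_cap_of_neg m (h := -ε) (by linarith) (by linarith)]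
      exact measure_mono fun x hx => lt_trans (by linarith) (mem_ofPred_eq ▸ hx)
    have hlow : ∀ ε : ℝ, 0 < ε → ε ≤ 1 → ENNReal.ofReal (2 * Real.pi * (1 - ε)) ≤
        (volume : Measure E3).toSphere {x : S2 | 0 < ⟪(m : E3), (x : E3)⟫} := by
      intro ε h2 h3
      rw [← toSphere_cap_of_pos m h2 h3 (measurableSet_cap m ε) (fun x hx => hx)
        (fun x hx => le_of_lt hx)]
      exact measure_mono fun x hx => lt_trans h2 hx
    have hev : ∀ᶠ ε : ℝ in nhdsWithin 0 (Ioi 0), 0 < ε ∧ ε ≤ 1 := by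
      filter_upwards [Ioc_mem_nhdsGT (zero_lt_one' ℝ)] with ε hε using hε
    have hl1 : Filter.Tendsto (fun ε : ℝ => ENNReal.ofReal (2 * Real.pi * (1 + ε)))
        (nhdsWithin 0 (Ioi 0)) (nhds (ENNReal.ofReal (2 * Real.pi * (1 + 0)))) :=
      ((ENNReal.continuous_ofReal.comp (by fun_prop)).tendsto 0).mono_left nhdsWithin_le_nhds
    have hl2 : Filter.Tendsto (fun ε : ℝ => ENNReal.ofReal (2 * Real.pi * (1 - ε)))
        (nhdsWithin 0 (Ioi 0)) (nhds (ENNReal.ofReal (2 * Real.pi * (1 - 0)))) :=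
      ((ENNReal.continuous_ofReal.comp (by fun_prop)).tendsto 0).mono_left nhdsWithin_le_nhds
    apply le_antisymm
    · have := ge_of_tendsto hl1 (hev.mono fun ε h => hup ε h.1 h.2)
      simpa using this
    · exact le_of_tendsto hl2 (hev.mono fun ε h => hlow ε h.1 h.2)
  · exact toSphere_cap_of_pos m hh h1 (measurableSet_cap m h) (fun x hx => hx)
      (fun x hx => le_of_lt hx)

theorem toSphere_circle (m : S2) {h : ℝ} (h0 : -1 < h) (h1 : h ≤ 1) :
    (volume : Measure E3).toSphere {x : S2 | ⟪(m : E3), (x : E3)⟫ = h} = 0 := by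
  have hle : ∀ ε : ℝ, 0 < ε → ε ≤ 1 + h → (volume : Measure E3).toSphere
      {x : S2 | ⟪(m : E3), (x : E3)⟫ = h} ≤ ENNReal.ofReal (2 * Real.pi * ε) := by
    intro ε h2 h3
    have hsub : {x : S2 | ⟪(m : E3), (x : E3)⟫ = h} ⊆
        {x : S2 | h - ε < ⟪(m : E3), (x : E3)⟫} \ {x : S2 | h < ⟪(m : E3), (x : E3)⟫} := by
      intro x hx
      simp only [mem_ofPred_eq] at hx
      constructor
      · simp only [mem_ofPred_eq, hx]; linarith
      · simp [hx]
    have hss : {x : S2 | h < ⟪(m : E3), (x : E3)⟫} ⊆ {x : S2 | h - ε < ⟪(m : E3), (x : E3)⟫} :=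
      fun x hx => lt_trans (show h - ε < h by linarith) hx
    refine (measure_mono hsub).trans ?_
    rw [measure_sdiff hss (measurableSet_cap m h).nullMeasurableSet (measure_ne_top _ _), toSphere_cap m (by linarith) h1,
      toSphere_cap m (by linarith) (by linarith), ← ENNReal.ofReal_sub _
        (mul_nonneg (by positivity) (by linarith))]
    apply ENNReal.ofReal_le_ofReal
    linarith
  have hl : Filter.Tendsto (fun ε : ℝ => ENNReal.ofReal (2 * Real.pi * ε))
      (nhdsWithin 0 (Ioi 0)) (nhds (ENNReal.ofReal (2 * Real.pi * 0))) :=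
    ((ENNReal.continuous_ofReal.comp (by fun_prop)).tendsto 0).mono_left nhdsWithin_le_nhds
  have hev : ∀ᶠ ε : ℝ in nhdsWithin 0 (Ioi 0), 0 < ε ∧ ε ≤ 1 + h := by
    filter_upwards [Ioc_mem_nhdsGT (show (0 : ℝ) < 1 + h by linarith)] with ε hε using hε
  have := ge_of_tendsto hl (hev.mono fun ε h => hle ε h.1 h.2)
  simpa using this

end Cap

/-! ### The potential of the sphere -/

theorem norm_sub_sq_sphere (c x : S2) : ‖(c : E3) - x‖ ^ 2 = 2 - 2 * ⟪(c : E3), (x : E3)⟫ := by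
  rw [norm_sub_sq_real]
  simp; ring

/-- The potential of the uniformly charged sphere is bounded on the sphere: the points at distance
less than `1 / t` from `c` form a cap of area `π / t ^ 2`, which is integrable at infinity. -/
theorem exists_lintegral_inv_dist_le :
    ∃ C : ENNReal, C ≠ ⊤ ∧ ∀ c : S2,
      ∫⁻ x : S2, ENNReal.ofReal ‖(c : E3) - x‖⁻¹ ∂(volume : Measure E3).toSphere ≤ C := by
  refine ⟨(∫⁻ _ in Ioc (0 : ℝ) 1, ENNReal.ofReal (4 * Real.pi)) +
    ∫⁻ t in Ioi (1 : ℝ), ENNReal.ofReal (Real.pi * t ^ (-2 : ℝ)), ?_, fun c => ?_⟩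
  · refine ENNReal.add_ne_top.mpr ⟨by simp [ENNReal.mul_eq_top], ?_⟩
    have hi : IntegrableOn (fun t : ℝ => Real.pi * t ^ (-2 : ℝ)) (Ioi 1) :=
      (integrableOn_Ioi_rpow_of_lt (by norm_num) one_pos).const_mul _
    exact hi.lintegral_lt_top.ne
  · have hm : Measurable fun x : S2 => ‖(c : E3) - x‖⁻¹ := by fun_prop
    rw [lintegral_eq_lintegral_meas_lt _ (.of_forall fun x => by positivity) hm.aemeasurable,
      ← Ioc_union_Ioi_eq_Ioi (zero_le_one' ℝ),
      lintegral_union measurableSet_Ioi (Ioc_disjoint_Ioi le_rfl)]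
    refine add_le_add (lintegral_mono fun t => ?_) (setLIntegral_mono' measurableSet_Ioi ?_)
    · rw [← toSphere_univ]
      exact measure_mono (subset_univ _)
    · intro t ht
      have ht0 : (0 : ℝ) < t := lt_trans one_pos ht
      have ht1 : (t ^ 2)⁻¹ ≤ 1 := inv_le_one_of_one_le₀ (one_le_pow₀ (le_of_lt ht))
      have ht2 : 0 < (t ^ 2)⁻¹ := by positivity
      have hsub : {x : S2 | t < ‖(c : E3) - x‖⁻¹} ⊆
          {x : S2 | 1 - (t ^ 2)⁻¹ / 2 < ⟪(c : E3), (x : E3)⟫} := by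
        intro x hx
        have h1 : ‖(c : E3) - x‖ < t⁻¹ := by
          have h0 : 0 < ‖(c : E3) - x‖⁻¹ := lt_trans ht0 hx
          rw [← inv_inv ‖(c : E3) - x‖]
          exact inv_strictAnti₀ ht0 hx
        have h2 : ‖(c : E3) - x‖ ^ 2 < (t⁻¹) ^ 2 := by gcongr
        rw [norm_sub_sq_sphere, inv_pow] at h2
        simp only [mem_ofPred_eq]
        linarith
      refine (measure_mono hsub).trans ?_
      rw [toSphere_cap c (by linarith) (by linarith)]
      apply ENNReal.ofReal_le_ofReal
      rw [Real.rpow_neg ht0.le, Real.rpow_two]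
      linarith

/-! ### The stereographic coordinate -/

/-- The orthogonal projection to the plane of the first two vectors of the basis, with this plane
identified with `ℂ`. -/
noncomputable def planeCoord (b : OrthonormalBasis (Fin 3) ℝ E3) : E3 →L[ℝ] ℂ :=
  Complex.equivRealProdCLM.symm.toContinuousLinearMap ∘L ((innerSL ℝ (b 0)).prod (innerSL ℝ (b 1)))

theorem planeCoord_re (b : OrthonormalBasis (Fin 3) ℝ E3) (x : E3) :
    (planeCoord b x).re = ⟪b 0, x⟫ := by simp [planeCoord]

theorem planeCoord_im (b : OrthonormalBasis (Fin 3) ℝ E3) (x : E3) :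
    (planeCoord b x).im = ⟪b 1, x⟫ := by simp [planeCoord]

/-- The complex coordinate given by stereographic projection from the point opposite to the third
basis vector.  It has the junk value `0` at that point. -/
noncomputable def stereoCoord (b : OrthonormalBasis (Fin 3) ℝ E3) (x : E3) : ℂ :=
  (2 / (1 + ⟪b 2, x⟫)) • planeCoord b x

theorem measurable_stereoCoord (b : OrthonormalBasis (Fin 3) ℝ E3) :
    Measurable (stereoCoord b) := by
  unfold stereoCoord
  fun_prop

theorem normSq_planeCoord (b : OrthonormalBasis (Fin 3) ℝ E3) (x : S2) :
    Complex.normSq (planeCoord b x) = 1 - ⟪b 2, (x : E3)⟫ ^ 2 := by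
  have hxx : ⟪(x : E3), (x : E3)⟫ = 1 := by rw [real_inner_self_eq_norm_sq]; simp
  rw [inner_eq_frame b] at hxx
  rw [Complex.normSq_apply, planeCoord_re, planeCoord_im]
  linarith

theorem inner_two_bounds (b : OrthonormalBasis (Fin 3) ℝ E3) (x : S2) :
    -1 ≤ ⟪b 2, (x : E3)⟫ ∧ ⟪b 2, (x : E3)⟫ ≤ 1 := by
  have h := Complex.normSq_nonneg (planeCoord b x)
  rw [normSq_planeCoord] at h
  constructor <;> nlinarith

theorem norm_stereoCoord_sq (b : OrthonormalBasis (Fin 3) ℝ E3) (x : S2)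
    (hx : 1 + ⟪b 2, (x : E3)⟫ ≠ 0) :
    ‖stereoCoord b x‖ ^ 2 = 4 * (1 - ⟪b 2, (x : E3)⟫) / (1 + ⟪b 2, (x : E3)⟫) := by
  rw [stereoCoord, norm_smul, mul_pow, ← Complex.normSq_eq_norm_sq, normSq_planeCoord,
    Real.norm_eq_abs, sq_abs]
  field_simp
  ring

theorem norm_stereoCoord_lt_iff (b : OrthonormalBasis (Fin 3) ℝ E3) (x c : S2)
    (hx : 1 + ⟪b 2, (x : E3)⟫ ≠ 0) (hc : 1 + ⟪b 2, (c : E3)⟫ ≠ 0) :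
    ‖stereoCoord b x‖ < ‖stereoCoord b c‖ ↔ ⟪b 2, (c : E3)⟫ < ⟪b 2, (x : E3)⟫ := by
  rw [← pow_lt_pow_iff_left₀ (norm_nonneg _) (norm_nonneg _) two_ne_zero,
    norm_stereoCoord_sq b x hx, norm_stereoCoord_sq b c hc]
  have hx' : 0 < 1 + ⟪b 2, (x : E3)⟫ :=
    lt_of_le_of_ne (by linarith [(inner_two_bounds b x).1]) hx.symm
  have hc' : 0 < 1 + ⟪b 2, (c : E3)⟫ :=
    lt_of_le_of_ne (by linarith [(inner_two_bounds b c).1]) hc.symm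
  rw [div_lt_div_iff₀ hx' hc']
  constructor <;> intro h <;> nlinarith

/-- Stereographic projection is expanding. -/
theorem norm_sub_le_norm_stereoCoord_sub (b : OrthonormalBasis (Fin 3) ℝ E3) (x c : S2)
    (hx : 1 + ⟪b 2, (x : E3)⟫ ≠ 0) (hc : 1 + ⟪b 2, (c : E3)⟫ ≠ 0) :
    ‖(c : E3) - x‖ ≤ ‖stereoCoord b c - stereoCoord b x‖ := by
  refine le_of_sq_le_sq ?_ (norm_nonneg _)
  have hx' : 0 < 1 + ⟪b 2, (x : E3)⟫ :=
    lt_of_le_of_ne (by linarith [(inner_two_bounds b x).1]) hx.symm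
  have hc' : 0 < 1 + ⟪b 2, (c : E3)⟫ :=
    lt_of_le_of_ne (by linarith [(inner_two_bounds b c).1]) hc.symm
  have hX := normSq_planeCoord b x
  have hC := normSq_planeCoord b c
  rw [Complex.normSq_apply, planeCoord_re, planeCoord_im] at hX hC
  have key : ‖stereoCoord b c - stereoCoord b x‖ ^ 2 =
      4 * ‖(c : E3) - x‖ ^ 2 / ((1 + ⟪b 2, (x : E3)⟫) * (1 + ⟪b 2, (c : E3)⟫)) := by
    rw [← Complex.normSq_eq_norm_sq, Complex.normSq_apply, norm_sub_sq_sphere, inner_eq_frame b]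
    simp only [stereoCoord, Complex.sub_re, Complex.sub_im, Complex.smul_re, Complex.smul_im,
      planeCoord_re, planeCoord_im, smul_eq_mul]
    generalize ⟪b 0, (x : E3)⟫ = x0 at *
    generalize ⟪b 1, (x : E3)⟫ = x1 at *
    generalize ⟪b 2, (x : E3)⟫ = x2 at *
    generalize ⟪b 0, (c : E3)⟫ = c0 at *
    generalize ⟪b 1, (c : E3)⟫ = c1 at *
    generalize ⟪b 2, (c : E3)⟫ = c2 at *
    field_simp
    linear_combination 2 * (1 + c2) ^ 2 * hX + 2 * (1 + x2) ^ 2 * hC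
  rw [key, le_div_iff₀ (by positivity)]
  have h4 : (1 + ⟪b 2, (x : E3)⟫) * (1 + ⟪b 2, (c : E3)⟫) ≤ 2 * 2 := by
    gcongr <;> linarith [(inner_two_bounds b c).2, (inner_two_bounds b x).2]
  nlinarith [sq_nonneg ‖(c : E3) - x‖]

/-! ### Rotations about the pole -/

/-- The rotation by the angle `φ` about the third basis vector. -/
noncomputable def rotation (b : OrthonormalBasis (Fin 3) ℝ E3) (φ : ℝ) : E3 →ₗ[ℝ] E3 where
  toFun y := (Real.cos φ * ⟪b 0, y⟫ - Real.sin φ * ⟪b 1, y⟫) • b 0 +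
    (Real.sin φ * ⟪b 0, y⟫ + Real.cos φ * ⟪b 1, y⟫) • b 1 + ⟪b 2, y⟫ • b 2
  map_add' x y := by simp only [inner_add_right]; module
  map_smul' a y := by simp only [inner_smul_right, RingHom.id_apply]; module

theorem rotation_apply (b : OrthonormalBasis (Fin 3) ℝ E3) (φ : ℝ) (y : E3) :
    rotation b φ y = (Real.cos φ * ⟪b 0, y⟫ - Real.sin φ * ⟪b 1, y⟫) • b 0 +
      (Real.sin φ * ⟪b 0, y⟫ + Real.cos φ * ⟪b 1, y⟫) • b 1 + ⟪b 2, y⟫ • b 2 := rfl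

theorem inner_zero_rotation (b : OrthonormalBasis (Fin 3) ℝ E3) (φ : ℝ) (y : E3) :
    ⟪b 0, rotation b φ y⟫ = Real.cos φ * ⟪b 0, y⟫ - Real.sin φ * ⟪b 1, y⟫ := by
  simp [rotation_apply, inner_add_right, inner_smul_right, inner_basis, -inner_self_eq_norm_sq_to_K]

theorem inner_one_rotation (b : OrthonormalBasis (Fin 3) ℝ E3) (φ : ℝ) (y : E3) :
    ⟪b 1, rotation b φ y⟫ = Real.sin φ * ⟪b 0, y⟫ + Real.cos φ * ⟪b 1, y⟫ := by
  simp [rotation_apply, inner_add_right, inner_smul_right, inner_basis, -inner_self_eq_norm_sq_to_K]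

theorem inner_two_rotation (b : OrthonormalBasis (Fin 3) ℝ E3) (φ : ℝ) (y : E3) :
    ⟪b 2, rotation b φ y⟫ = ⟪b 2, y⟫ := by
  simp [rotation_apply, inner_add_right, inner_smul_right, inner_basis, -inner_self_eq_norm_sq_to_K]

theorem norm_rotation (b : OrthonormalBasis (Fin 3) ℝ E3) (φ : ℝ) (y : E3) :
    ‖rotation b φ y‖ = ‖y‖ := by
  rw [← sq_eq_sq₀ (norm_nonneg _) (norm_nonneg _), ← real_inner_self_eq_norm_sq,
    ← real_inner_self_eq_norm_sq, inner_eq_frame b, inner_eq_frame b y y, inner_zero_rotation,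
    inner_one_rotation, inner_two_rotation]
  linear_combination (⟪b 0, y⟫ ^ 2 + ⟪b 1, y⟫ ^ 2) * Real.sin_sq_add_cos_sq φ

/-- The rotation by the angle `φ` about the third basis vector, as a map of the sphere. -/
noncomputable def sphereRotation (b : OrthonormalBasis (Fin 3) ℝ E3) (φ : ℝ) (x : S2) : S2 :=
  ⟨rotation b φ x, by simp [norm_rotation]⟩

theorem continuous_sphereRotation (b : OrthonormalBasis (Fin 3) ℝ E3) :
    Continuous (Function.uncurry (sphereRotation b)) := by
  refine continuous_induced_rng.mpr ?_
  have e : (Subtype.val ∘ Function.uncurry (sphereRotation b)) =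
      fun q : ℝ × S2 => rotation b q.1 q.2 := rfl
  rw [e]
  simp only [rotation_apply]
  fun_prop

theorem measurePreserving_sphereRotation (b : OrthonormalBasis (Fin 3) ℝ E3) (φ : ℝ) :
    MeasurePreserving (sphereRotation b φ) (volume : Measure E3).toSphere
      (volume : Measure E3).toSphere :=
  measurePreserving_sphere
    (LinearIsometry.toLinearIsometryEquiv ⟨rotation b φ, norm_rotation b φ⟩ rfl) _ fun _ => rfl

theorem stereoCoord_sphereRotation (b : OrthonormalBasis (Fin 3) ℝ E3) (φ : ℝ) (x : S2) :
    stereoCoord b (sphereRotation b φ x) = circleMap 0 1 φ * stereoCoord b x := by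
  have h : planeCoord b (sphereRotation b φ x) = circleMap 0 1 φ * planeCoord b x := by
    have e : circleMap 0 1 φ = ⟨Real.cos φ, Real.sin φ⟩ := by
      rw [circleMap_zero]
      apply Complex.ext <;> simp [Complex.exp_ofReal_mul_I_re, Complex.exp_ofReal_mul_I_im]
    rw [e]
    apply Complex.ext
    · rw [Complex.mul_re, planeCoord_re, planeCoord_re, planeCoord_im]
      exact inner_zero_rotation b φ x
    · rw [Complex.mul_im, planeCoord_im, planeCoord_re, planeCoord_im]
      exact (inner_one_rotation b φ x).trans (by ring)
  rw [stereoCoord, stereoCoord, h,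
    show ⟪b 2, (sphereRotation b φ x : E3)⟫ = ⟪b 2, (x : E3)⟫ from inner_two_rotation b φ x,
    mul_smul_comm]

/-! ### Circle averages of the Cauchy kernel -/

theorem circleAverage_div_sub_of_lt (w z s : ℂ) (h : ‖s‖ < ‖z‖) :
    Real.circleAverage (fun ζ => w / (z - ζ * s)) 0 1 = w / z := by
  have hne : ∀ ζ ∈ closedBall (0 : ℂ) |1|, z - ζ * s ≠ 0 := by
    intro ζ hζ h0
    rw [mem_closedBall_zero_iff, abs_one] at hζ
    have : ‖z‖ = ‖ζ‖ * ‖s‖ := by rw [sub_eq_zero.mp h0, norm_mul]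
    nlinarith [norm_nonneg s]
  have hd : ∀ ζ ∈ closedBall (0 : ℂ) |1|, DifferentiableAt ℂ (fun ζ => w / (z - ζ * s)) ζ :=
    fun ζ hζ => by
      have := hne ζ hζ
      fun_prop (disch := assumption)
  have := circleAverage_of_differentiable_on_off_countable (R := 1) (c := (0 : ℂ))
    (f := fun ζ => w / (z - ζ * s)) countable_empty
    (fun ζ hζ => (hd ζ hζ).continuousAt.continuousWithinAt)
    (fun ζ hζ => hd ζ (ball_subset_closedBall hζ.1))
  simpa using this

theorem circleAverage_div_sub_of_gt (w z s : ℂ) (h : ‖z‖ < ‖s‖) :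
    Real.circleAverage (fun ζ => w / (z - ζ * s)) 0 1 = 0 := by
  -- after `ζ ↦ ζ⁻¹` the integrand is holomorphic on the disc, and it vanishes at the centre
  rw [← Real.circleAverage_zero_one_congr_inv]
  have hne : ∀ ζ ∈ closedBall (0 : ℂ) |1|, z * ζ - s ≠ 0 := by
    intro ζ hζ h0
    rw [mem_closedBall_zero_iff, abs_one] at hζ
    have : ‖s‖ = ‖z‖ * ‖ζ‖ := by rw [← sub_eq_zero.mp h0, norm_mul]
    nlinarith [norm_nonneg z]
  have hd : ∀ ζ ∈ closedBall (0 : ℂ) |1|, DifferentiableAt ℂ (fun ζ => w * ζ / (z * ζ - s)) ζ :=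
    fun ζ hζ => by
      have := hne ζ hζ
      fun_prop (disch := assumption)
  have := circleAverage_of_differentiable_on_off_countable (R := 1) (c := (0 : ℂ))
    (f := fun ζ => w * ζ / (z * ζ - s)) countable_empty
    (fun ζ hζ => (hd ζ hζ).continuousAt.continuousWithinAt)
    (fun ζ hζ => hd ζ (ball_subset_closedBall hζ.1))
  rw [Real.circleAverage_congr_sphere (f₂ := fun ζ => w * ζ / (z * ζ - s))]
  · simpa using this
  · intro ζ hζ
    have hζ0 : ζ ≠ 0 := by
      rintro rfl
      simp at hζ
    have h1 := hne ζ (sphere_subset_closedBall hζ)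
    have h2 : z - ζ⁻¹ * s = (z * ζ - s) / ζ := by field_simp
    simp only
    rw [h2, div_div_eq_mul_div]

theorem integral_im_div_sub (w z s : ℂ) (h : ‖s‖ ≠ ‖z‖) :
    ∫ φ in (0 : ℝ)..2 * Real.pi, (w / (z - circleMap 0 1 φ * s)).im =
      if ‖s‖ < ‖z‖ then 2 * Real.pi * (w / z).im else 0 := by
  have hne : ∀ φ : ℝ, z - circleMap 0 1 φ * s ≠ 0 := by
    intro φ h0
    apply h
    rw [sub_eq_zero.mp h0, norm_mul]; simp
  have hc : Continuous fun φ : ℝ => w / (z - circleMap 0 1 φ * s) :=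
    continuous_const.div (by fun_prop) hne
  have him : ∫ φ in (0 : ℝ)..2 * Real.pi, (w / (z - circleMap 0 1 φ * s)).im =
      (∫ φ in (0 : ℝ)..2 * Real.pi, w / (z - circleMap 0 1 φ * s)).im :=
    Complex.imCLM.intervalIntegral_comp_comm (hc.intervalIntegrable _ _)
  have hci : ∫ φ in (0 : ℝ)..2 * Real.pi, w / (z - circleMap 0 1 φ * s) =
      (2 * Real.pi) • Real.circleAverage (fun ζ => w / (z - ζ * s)) 0 1 := by
    rw [Real.circleAverage_def, smul_smul, mul_inv_cancel₀ (by positivity), one_smul]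
  rw [him, hci]
  split_ifs with hlt
  · rw [circleAverage_div_sub_of_lt w z s hlt, Complex.smul_im, smul_eq_mul]
  · rw [circleAverage_div_sub_of_gt w z s (lt_of_le_of_ne (not_lt.mp hlt) h.symm)]
    simp

/-! ### The mean field of the sphere in the stereographic plane -/

theorem ae_one_add_inner_ne_zero (b : OrthonormalBasis (Fin 3) ℝ E3) :
    ∀ᵐ x : S2 ∂(volume : Measure E3).toSphere, 1 + ⟪b 2, (x : E3)⟫ ≠ 0 := by
  have hm : -b 2 ∈ sphere (0 : E3) 1 := by simp
  have h := toSphere_circle ⟨-b 2, hm⟩ (h := 1) (by norm_num) le_rfl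
  rw [ae_iff]
  convert h using 2
  ext x
  simp only [mem_ofPred_eq, not_not, inner_neg_left]
  constructor <;> intro h <;> linarith

theorem abs_im_div_stereoCoord_sub_le (b : OrthonormalBasis (Fin 3) ℝ E3) (w : ℂ) (x c : S2)
    (hx : 1 + ⟪b 2, (x : E3)⟫ ≠ 0) (hc : 1 + ⟪b 2, (c : E3)⟫ ≠ 0) :
    ‖(w / (stereoCoord b c - stereoCoord b x)).im‖ ≤ ‖w‖ * ‖(c : E3) - x‖⁻¹ := by
  refine (Complex.abs_im_le_norm _).trans ?_
  rw [norm_div, div_eq_mul_inv]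
  rcases eq_or_ne c x with rfl | hne
  · simp
  · have h0 : 0 < ‖(c : E3) - x‖ := norm_pos_iff.mpr (sub_ne_zero.mpr fun h => hne (Subtype.ext h))
    gcongr
    exact norm_sub_le_norm_stereoCoord_sub b x c hx hc

theorem integrable_inv_dist (c : S2) :
    Integrable (fun x : S2 => ‖(c : E3) - x‖⁻¹) (volume : Measure E3).toSphere := by
  obtain ⟨C, hC, h⟩ := exists_lintegral_inv_dist_le
  refine ⟨by fun_prop, ?_⟩
  rw [hasFiniteIntegral_iff_ofReal (.of_forall fun x => by positivity)]
  exact (h c).trans_lt hC.lt_top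

theorem integrable_im_div_stereoCoord_sub (b : OrthonormalBasis (Fin 3) ℝ E3) (w : ℂ) (c : S2)
    (hc : 1 + ⟪b 2, (c : E3)⟫ ≠ 0) :
    Integrable (fun x : S2 => (w / (stereoCoord b c - stereoCoord b x)).im)
      (volume : Measure E3).toSphere := by
  refine ((integrable_inv_dist c).const_mul ‖w‖).mono' ?_ ?_
  · have hm := measurable_stereoCoord b
    have : Measurable fun x : S2 => (w / (stereoCoord b c - stereoCoord b x)).im := by fun_prop
    exact this.aestronglyMeasurable
  · filter_upwards [ae_one_add_inner_ne_zero b] with x hx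
    exact abs_im_div_stereoCoord_sub_le b w x c hx hc

/-- Newton's shell theorem in the plane: by averaging over the rotations about the third basis
vector, only the part of the sphere whose stereographic image is closer to the origin than that of
`c` contributes, and it acts as if it were concentrated at the origin. -/
theorem integral_im_div_stereoCoord_sub (b : OrthonormalBasis (Fin 3) ℝ E3) (w : ℂ) (c : S2)
    (hc : 1 + ⟪b 2, (c : E3)⟫ ≠ 0) :
    ∫ x : S2, (w / (stereoCoord b c - stereoCoord b x)).im ∂(volume : Measure E3).toSphere =
      2 * Real.pi * (1 - ⟪b 2, (c : E3)⟫) * (w / stereoCoord b c).im := by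
  set μ := (volume : Measure E3).toSphere with hμ
  set f : S2 → ℝ := fun x => (w / (stereoCoord b c - stereoCoord b x)).im with hf
  have hfi : Integrable f μ := integrable_im_div_stereoCoord_sub b w c hc
  set ν : Measure ℝ := volume.restrict (Ioc 0 (2 * Real.pi)) with hν
  have hmp : MeasurePreserving (fun q : ℝ × S2 => (q.1, sphereRotation b q.1 q.2))
      (ν.prod μ) (ν.prod μ) :=
    (MeasurePreserving.id ν).skew_product (g := sphereRotation b)
      (continuous_sphereRotation b).measurable
      (.of_forall fun φ => (measurePreserving_sphereRotation b φ).map_eq)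
  have hint : Integrable (fun q : ℝ × S2 => f (sphereRotation b q.1 q.2)) (ν.prod μ) :=
    hmp.integrable_comp_of_integrable (hfi.comp_snd ν)
  have hinv : ∀ φ, ∫ x, f (sphereRotation b φ x) ∂μ = ∫ x, f x ∂μ := by
    intro φ
    have hp := measurePreserving_sphereRotation b φ
    have := integral_map (μ := μ) hp.measurable.aemeasurable (f := f)
      (by rw [hp.map_eq]; exact hfi.aestronglyMeasurable)
    rw [← this, hp.map_eq]
  have hswap : ∫ φ, ∫ x, f (sphereRotation b φ x) ∂μ ∂ν =
      ∫ x, ∫ φ, f (sphereRotation b φ x) ∂ν ∂μ := integral_integral_swap hint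
  have hleft : ∫ φ, ∫ x, f (sphereRotation b φ x) ∂μ ∂ν = 2 * Real.pi * ∫ x, f x ∂μ := by
    simp only [hinv, integral_const, hν, measureReal_restrict_apply_univ, smul_eq_mul]
    rw [Real.volume_real_Ioc_of_le (by positivity), sub_zero]
  have hright : ∫ x, ∫ φ, f (sphereRotation b φ x) ∂ν ∂μ =
      ∫ x, {x : S2 | ⟪b 2, (c : E3)⟫ < ⟪b 2, (x : E3)⟫}.indicator
        (fun _ => 2 * Real.pi * (w / stereoCoord b c).im) x ∂μ := by
    have hm : b 2 ∈ sphere (0 : E3) 1 := by simp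
    have hcirc : ∀ᵐ x : S2 ∂μ, ⟪b 2, (x : E3)⟫ ≠ ⟪b 2, (c : E3)⟫ := by
      have h1 := inner_two_bounds b c
      have := toSphere_circle ⟨b 2, hm⟩ (h := ⟪b 2, (c : E3)⟫)
        (lt_of_le_of_ne h1.1 fun h => hc (by linarith)) h1.2
      rw [ae_iff]
      simpa using this
    refine integral_congr_ae ?_
    filter_upwards [ae_one_add_inner_ne_zero b, hcirc] with x hx hxc
    have hne : ‖stereoCoord b x‖ ≠ ‖stereoCoord b c‖ := by
      rcases lt_or_gt_of_ne hxc with h | h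
      · exact ((norm_stereoCoord_lt_iff b c x hc hx).mpr h).ne'
      · exact ((norm_stereoCoord_lt_iff b x c hx hc).mpr h).ne
    rw [hν, ← intervalIntegral.integral_of_le (by positivity)]
    simp only [hf, stereoCoord_sphereRotation]
    rw [integral_im_div_sub w _ _ hne]
    simp only [norm_stereoCoord_lt_iff b x c hx hc, indicator, mem_ofPred_eq]
  have hm : b 2 ∈ sphere (0 : E3) 1 := by simp
  rw [hleft, hright, integral_indicator (measurableSet_cap ⟨b 2, hm⟩ _), setIntegral_const,
    measureReal_def, hμ, toSphere_cap ⟨b 2, hm⟩ (inner_two_bounds b c).1 (inner_two_bounds b c).2,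
    ENNReal.toReal_ofReal, smul_eq_mul] at hswap
  · rw [← hμ] at hswap
    apply mul_left_cancel₀ (show 2 * Real.pi ≠ 0 by positivity)
    rw [hswap]; ring
  · have := (inner_two_bounds b c).2
    exact mul_nonneg (by positivity) (by linarith)

/-! ### The enclosed area as a line integral -/

theorem hasDerivAt_stereoCoord (b : OrthonormalBasis (Fin 3) ℝ E3) {q : ℝ → E3} {d : E3} {t : ℝ}
    (hq : HasDerivAt q d t) (hD : 1 + ⟪b 2, q t⟫ ≠ 0) :
    HasDerivAt (fun s => stereoCoord b (q s))
      ((2 / (1 + ⟪b 2, q t⟫)) • planeCoord b d +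
        (-(2 * ⟪b 2, d⟫) / (1 + ⟪b 2, q t⟫) ^ 2) • planeCoord b (q t)) t := by
  have h2 : HasDerivAt (fun s => ⟪b 2, q s⟫) ⟪b 2, d⟫ t := by
    simpa using (hasDerivAt_const t (b 2)).inner ℝ hq
  have h1 := ((hasDerivAt_const t (2 : ℝ)).div (h2.const_add 1) hD).smul
    ((planeCoord b).hasFDerivAt.comp_hasDerivAt t hq)
  refine h1.congr_deriv ?_
  simp

/-- The angular speed about the origin of a moving point in the stereographic plane, times the
height of the cap that it bounds, is the primitive of the area form.  At the origin both sides
vanish, the left one because of division by zero. -/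
theorem im_deriv_div_stereoCoord (b : OrthonormalBasis (Fin 3) ℝ E3) (x : S2) (d : E3)
    (hD : 1 + ⟪b 2, (x : E3)⟫ ≠ 0) :
    (1 - ⟪b 2, (x : E3)⟫) * (((2 / (1 + ⟪b 2, (x : E3)⟫)) • planeCoord b d +
        (-(2 * ⟪b 2, d⟫) / (1 + ⟪b 2, (x : E3)⟫) ^ 2) • planeCoord b x) / stereoCoord b x).im =
      areaPrimitive b x d := by
  have hX := normSq_planeCoord b x
  by_cases h0 : Complex.normSq (planeCoord b x) = 0
  · have h1 : planeCoord b x = 0 := by simpa using h0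
    have hre := planeCoord_re b x
    have him := planeCoord_im b x
    rw [h1] at hre him
    simp only [Complex.zero_re, Complex.zero_im] at hre him
    simp [stereoCoord, h1, areaPrimitive, ← hre, ← him]
  · have h3 : 1 - ⟪b 2, (x : E3)⟫ ≠ 0 := by
      intro h
      rw [hX] at h0
      exact h0 (by linear_combination (1 + ⟪b 2, (x : E3)⟫) * h)
    have h4 : Complex.normSq (stereoCoord b x) =
        4 * (1 - ⟪b 2, (x : E3)⟫) / (1 + ⟪b 2, (x : E3)⟫) := by
      rw [Complex.normSq_eq_norm_sq, norm_stereoCoord_sq b x hD]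
    rw [Complex.div_im, h4, areaPrimitive]
    simp only [stereoCoord, Complex.add_re, Complex.add_im, Complex.smul_re, Complex.smul_im,
      planeCoord_re, planeCoord_im, smul_eq_mul]
    field_simp
    ring

theorem stereoToFun_eq (b : OrthonormalBasis (Fin 3) ℝ E3) {p : E3} (hbp : b 2 = -p) (x : E3) :
    (stereoToFun p x : E3) = (2 / (1 + ⟪b 2, x⟫)) • (⟪b 0, x⟫ • b 0 + ⟪b 1, x⟫ • b 1) := by
  have hp : p = -b 2 := by rw [hbp, neg_neg]
  have hpp : ‖p‖ = 1 := by rw [hp, norm_neg]; simp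
  have hx : x = ⟪b 0, x⟫ • b 0 + ⟪b 1, x⟫ • b 1 + ⟪b 2, x⟫ • b 2 := by
    refine ext_frame b ?_ ?_ ?_ <;>
      simp [inner_add_right, inner_smul_right, inner_basis, -inner_self_eq_norm_sq_to_K]
  rw [stereoToFun_apply, Submodule.coe_smul, Submodule.coe_orthogonalProjectionOnto_apply,
    Submodule.starProjection_orthogonal_val, Submodule.starProjection_unit_singleton ℝ hpp,
    innerSL_apply_apply, hp, inner_neg_left, sub_neg_eq_add]
  congr 1
  nth_rw 1 [hx]
  module

theorem planeCoord_stereoToFun (b : OrthonormalBasis (Fin 3) ℝ E3) {p : E3} (hbp : b 2 = -p) (x : E3) :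
    planeCoord b (stereoToFun p x) = stereoCoord b x ∧ ⟪b 2, (stereoToFun p x : E3)⟫ = 0 := by
  rw [stereoToFun_eq b hbp]
  constructor
  · rw [stereoCoord, map_smul]
    congr 1
    apply Complex.ext <;>
    simp [planeCoord_re, planeCoord_im, inner_basis, -inner_self_eq_norm_sq_to_K]
  · simp [inner_add_right, inner_smul_right, -inner_self_eq_norm_sq_to_K]

/-- The integrand of the winding number in the stereographic coordinate. -/
theorem windingNumber_integrand {b : OrthonormalBasis (Fin 3) ℝ E3} (hb : IsPositive b) {p : E3}
    (hbp : b 2 = -p) {q : ℝ → E3} {d : E3} {t : ℝ} (hq : HasDerivAt q d t)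
    (hD : 1 + ⟪b 2, q t⟫ ≠ 0) (x : E3) :
    ⟪cross ((stereoToFun p (q t) : E3) - stereoToFun p x)
      (deriv (fun s => (stereoToFun p (q s) : E3) - stereoToFun p x) t), -p⟫ /
      ‖(stereoToFun p (q t) : E3) - stereoToFun p x‖ ^ 2 =
    (deriv (fun s => stereoCoord b (q s)) t / (stereoCoord b (q t) - stereoCoord b x)).im := by
  have hi : ∀ i, DifferentiableAt ℝ (fun s => ⟪b i, q s⟫) t := fun i =>
    ((hasDerivAt_const t (b i)).inner ℝ hq).differentiableAt
  have hdiff : DifferentiableAt ℝ (fun s => (stereoToFun p (q s) : E3) - stereoToFun p x) t := by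
    simp only [stereoToFun_eq b hbp]
    exact (((differentiableAt_const (2 : ℝ)).div ((hi 2).const_add 1) hD).smul
      (((hi 0).smul_const _).add ((hi 1).smul_const _))).sub_const _
  set u : ℝ → E3 := fun s => (stereoToFun p (q s) : E3) - stereoToFun p x with hu
  have hU : ∀ s, planeCoord b (u s) = stereoCoord b (q s) - stereoCoord b x := fun s => by
    rw [hu, map_sub, (planeCoord_stereoToFun b hbp _).1, (planeCoord_stereoToFun b hbp _).1]
  have hu2 : ⟪b 2, u t⟫ = 0 := by
    rw [hu, inner_sub_right, (planeCoord_stereoToFun b hbp _).2, (planeCoord_stereoToFun b hbp _).2, sub_zero]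
  have hdU : planeCoord b (deriv u t) = deriv (fun s => stereoCoord b (q s)) t := by
    have h := ((planeCoord b).hasFDerivAt.comp_hasDerivAt t hdiff.hasDerivAt).deriv
    rw [← h, show (planeCoord b ∘ u) = fun s => stereoCoord b (q s) - stereoCoord b x from funext hU,
      deriv_sub_const]
  change ⟪cross (u t) (deriv u t), -p⟫ / ‖u t‖ ^ 2 = _
  rw [← hdU, ← hU, ← hbp, real_inner_comm, hb.inner_two_cross, Complex.div_im,
    ← real_inner_self_eq_norm_sq, inner_eq_frame b (u t) (u t), hu2, Complex.normSq_apply]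
  simp only [planeCoord_re, planeCoord_im]
  rw [mul_zero, add_zero, ← sub_div]
  congr 1; ring

/-- The algebraic area enclosed by a closed curve is the integral along the curve of a primitive of
the area form. -/
theorem algebraicArea_eq_integral {b : OrthonormalBasis (Fin 3) ℝ E3} (hb : IsPositive b) {p : S2}
    (hbp : b 2 = -(p : E3)) {r : ℝ → S2} {t₀ t₁ : ℝ} (ht : t₀ ≤ t₁)
    (hr : ContDiff ℝ 1 (fun t => (r t : E3)))
    (hD : ∀ t ∈ Icc t₀ t₁, 1 + ⟪b 2, (r t : E3)⟫ ≠ 0) :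
    algebraicArea p r t₀ t₁ =
      ∫ t in t₀..t₁, areaPrimitive b (r t) (deriv (fun s => (r s : E3)) t) := by
  set μ := (volume : Measure E3).toSphere with hμ
  set q : ℝ → E3 := fun t => r t with hq
  set Z : ℝ → ℂ := fun s => stereoCoord b (q s) with hZ
  have hqd : ∀ t, HasDerivAt q (deriv q t) t := fun t =>
    (hr.differentiable one_ne_zero t).hasDerivAt
  have hqc : Continuous q := hr.continuous
  have hqc' : Continuous (deriv q) := hr.continuous_deriv le_rfl
  set F : ℝ → S2 → ℝ := fun t x => (deriv Z t / (Z t - stereoCoord b x)).im with hF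
  have hw : ∀ x : S2, windingNumber p r t₀ t₁ x =
      (2 * Real.pi)⁻¹ * ∫ t in Ioc t₀ t₁, F t x := by
    intro x
    rw [windingNumber, ← intervalIntegral.integral_of_le ht]
    congr 1
    refine intervalIntegral.integral_congr fun t htt => ?_
    rw [uIcc_of_le ht] at htt
    exact windingNumber_integrand hb hbp (hqd t) (hD t htt) x
  have hZ' : ∀ t ∈ Icc t₀ t₁, deriv Z t = (2 / (1 + ⟪b 2, q t⟫)) • planeCoord b (deriv q t) +
        (-(2 * ⟪b 2, deriv q t⟫) / (1 + ⟪b 2, q t⟫) ^ 2) • planeCoord b (q t) := fun t h =>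
    (hasDerivAt_stereoCoord b (hqd t) (hD t h)).deriv
  obtain ⟨B, hB⟩ : ∃ B, ∀ t ∈ Icc t₀ t₁, ‖deriv Z t‖ ≤ B := by
    refine isCompact_Icc.exists_bound_of_continuousOn (ContinuousOn.congr ?_ hZ')
    have h2 : Continuous fun t => 1 + ⟪b 2, q t⟫ := by fun_prop
    refine ContinuousOn.add (ContinuousOn.smul (continuousOn_const.div h2.continuousOn hD)
      (by fun_prop)) (ContinuousOn.smul (ContinuousOn.div (by fun_prop) (h2.pow 2).continuousOn
        fun t h => pow_ne_zero 2 (hD t h)) (by fun_prop))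
  have hB0 : 0 ≤ B := (norm_nonneg _).trans (hB t₀ ⟨le_rfl, ht⟩)
  have hrm : Measurable r := by
    refine (continuous_induced_rng.mpr ?_).measurable
    exact hqc
  have hbound : Integrable (fun y : ℝ × S2 => B * ‖q y.1 - y.2‖⁻¹)
      ((volume.restrict (Ioc t₀ t₁)).prod μ) := by
    refine Integrable.const_mul ?_ B
    have hm : Measurable fun y : ℝ × S2 => ‖q y.1 - y.2‖⁻¹ := by
      have := hqc.measurable
      fun_prop
    refine ⟨hm.aestronglyMeasurable, ?_⟩
    rw [hasFiniteIntegral_iff_ofReal (.of_forall fun x => by positivity),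
      lintegral_prod _ (by fun_prop)]
    obtain ⟨C, hC, h⟩ := exists_lintegral_inv_dist_le
    calc _ ≤ ∫⁻ _ in Ioc t₀ t₁, C := lintegral_mono fun t => h (r t)
      _ < ⊤ := by
        rw [setLIntegral_const]
        exact ENNReal.mul_lt_top hC.lt_top (by simp)
  have hFi : Integrable (Function.uncurry F) ((volume.restrict (Ioc t₀ t₁)).prod μ) := by
    refine hbound.mono' ?_ ?_
    · have h1 := measurable_stereoCoord b
      have h2 : Measurable (deriv Z) := measurable_deriv Z
      have h3 : Measurable Z := h1.comp hqc.measurable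
      have : Measurable (Function.uncurry F) := by
        change Measurable fun y : ℝ × S2 => (deriv Z y.1 / (Z y.1 - stereoCoord b y.2)).im
        fun_prop
      exact this.aestronglyMeasurable
    · have h1 : ∀ᵐ y ∂(volume.restrict (Ioc t₀ t₁)).prod μ, y.1 ∈ Ioc t₀ t₁ :=
        Measure.quasiMeasurePreserving_fst.ae (ae_restrict_mem measurableSet_Ioc)
      have h2 : ∀ᵐ y ∂(volume.restrict (Ioc t₀ t₁)).prod μ, 1 + ⟪b 2, (y.2 : E3)⟫ ≠ 0 :=
        Measure.quasiMeasurePreserving_snd.ae (ae_one_add_inner_ne_zero b)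
      filter_upwards [h1, h2] with y hy1 hy2
      have hy1' := Ioc_subset_Icc_self hy1
      refine (abs_im_div_stereoCoord_sub_le b _ y.2 (r y.1) hy2 (hD _ hy1')).trans ?_
      exact mul_le_mul_of_nonneg_right (hB _ hy1') (by positivity)
  have hswap : ∫ x, (∫ t in Ioc t₀ t₁, F t x) ∂μ = ∫ t in Ioc t₀ t₁, (∫ x, F t x ∂μ) :=
    (integral_integral_swap hFi).symm
  rw [algebraicArea]
  simp only [hw]
  rw [integral_const_mul, hswap, intervalIntegral.integral_of_le ht, ← integral_const_mul]
  refine setIntegral_congr_fun measurableSet_Ioc fun t htt => ?_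
  have htt' := Ioc_subset_Icc_self htt
  have h1 := integral_im_div_stereoCoord_sub b (deriv Z t) (r t) (hD t htt')
  have h2 := im_deriv_div_stereoCoord b (r t) (deriv q t) (hD t htt')
  rw [← hZ' t htt'] at h2
  simp only [hF]
  rw [h1, mul_assoc, h2, inv_mul_cancel_left₀ (by positivity)]

/-! ### The Berry phase formula -/

theorem IsBicycleMotion.contDiff {Γ : ℝ → E3} {ℓ : ℝ} (hΓ : ContDiff ℝ ∞ Γ) {r : ℝ → S2}
    (hr : IsBicycleMotion Γ ℓ r) : ContDiff ℝ 1 (fun t => (r t : E3)) := by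
  have hv : Continuous (deriv Γ) := hΓ.continuous_deriv (by simp)
  have hrc := hr.continuous
  refine contDiff_one_iff_deriv.mpr ⟨fun t => (hr t).differentiableAt, ?_⟩
  rw [funext fun t => (hr t).deriv]
  fun_prop

theorem stretch_inv_eq_exp (Γ : ℝ → E3) (ℓ : ℝ) (t₀ t₁ : ℝ) (r : ℝ → S2) :
    (stretch Γ ℓ t₀ r t₁)⁻¹ = Real.exp (-(signedLength Γ r t₀ t₁ / ℓ)) := by
  rw [stretch, signedLength, ← Real.exp_neg, intervalIntegral.integral_const_mul]
  simp only [real_inner_comm (deriv Γ _)]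
  congr 1; ring

theorem smul_tangentMul (x : S2) (a : ℝ) (z : ℂ) (ξ : E3) :
    a • tangentMul x z ξ = tangentMul x (a * z) ξ := by
  simp only [tangentMul, Complex.re_ofReal_mul, Complex.im_ofReal_mul]
  module

end Bicycle

theorem corollary2p10 (ℓ : ℝ) (hℓ : 0 < ℓ) (Γ : ℝ → Bicycle.E3) (hΓ : ContDiff ℝ ∞ Γ)
    (t₀ t₁ : ℝ) (ht : t₀ < t₁) (hclosed : Γ t₀ = Γ t₁)
    (r₀ : Bicycle.S2) (hfix : Bicycle.monodromy hΓ ℓ t₀ t₁ r₀ = r₀)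
    (p : Bicycle.S2) (hp : ∀ t ∈ Set.Icc t₀ t₁, Bicycle.bicycleMotion hΓ ℓ t₀ r₀ t ≠ p) :
    Bicycle.HasComplexDerivAtFixedPoint (Bicycle.monodromy hΓ ℓ t₀ t₁) r₀
      (Complex.exp
        (-((Bicycle.signedLength Γ (Bicycle.bicycleMotion hΓ ℓ t₀ r₀) t₀ t₁ / ℓ : ℝ) : ℂ)
          + Complex.I *
            (Bicycle.algebraicArea p (Bicycle.bicycleMotion hΓ ℓ t₀ r₀) t₀ t₁ : ℂ))) := by
  open Bicycle in
  obtain ⟨hr, hr0⟩ := bicycleMotion_spec hΓ ℓ t₀ r₀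
  obtain ⟨hd, hd'⟩ := mfderiv_monodromy hΓ ℓ t₀ t₁ r₀
  have hr1 : bicycleMotion hΓ ℓ t₀ r₀ t₁ = r₀ := hfix
  set r := bicycleMotion hΓ ℓ t₀ r₀ with hrdef
  -- the frame is singular only at `p`, where the curve never passes
  obtain ⟨b, hb, hbp⟩ := exists_isPositive (-(p : E3)) (by simp)
  have hD : ∀ t ∈ Icc t₀ t₁, 1 + ⟪b 2, (r t : E3)⟫ ≠ 0 := by
    intro t h h0
    rw [hbp, inner_neg_left] at h0
    refine hp t h (Subtype.ext ?_)
    exact ((inner_eq_one_iff_of_norm_eq_one (𝕜 := ℝ) (by simp) (by simp)).mp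
      (by linarith)).symm
  refine ⟨hfix, hd, fun ξ => ?_⟩
  obtain ⟨ζ, hζ, hζ0, hM⟩ := hd' ξ
  have hol := hζ.holonomy hb hΓ hr ht.le hD (hr1.trans hr0.symm)
  rw [hM, hol, hζ0, hr0, smul_tangentMul, stretch_inv_eq_exp,
    algebraicArea_eq_integral hb hbp ht.le (hr.contDiff hΓ) hD, Complex.exp_add]
  push_cast
  rfl
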